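/- Let $V\in C_c^\infty(\mathbb R^3)$ be real valued with $V\le 0$, and let $H=-\Delta+V$ be the Schrödinger operator on $L^2(\mathbb R^3)$ with domain $H^2(\mathbb R^3)$. Assume that $0$ is not an eigenvalue of $H$ and that the discrete spectrum $\sigma_d(H)$ (the isolated points of the spectrum that are eigenvalues of finite multiplicity) consists of a single eigenvalue $E<0$, which is non-degenerate. Let $p_E$ be the orthogonal projection onto $\ker(H-E)$, let $P_{\rm disc}$ be the spectral projection to the discrete spectrum, and let $P_{\rm ess}=1-P_{\rm disc}$. Let $\chi$ be a (complex valued) Schwartz function on $\mathbb R^3$ which is equal to a constant $c\neq 0$ in a neighbourhood of the origin. Let $\kappa:(0,\infty)\to\mathbb C$ be a $C^3$ function, not identically zero, such that $\sup_{\omega\ge 1}\omega^n|\kappa(\omega)|<\infty$ for all $n\in\mathbb N_0$, and such that either there are $k_1,k_2>0$ and $p>2$ with $|\kappa^{(j)}(\omega)|\le k_2\,\omega^{p-j}$ for all $0<\omega<k_1$ and $0\le j\le 3$, or $\kappa(\omega)=\omega^{1/2}\tilde\kappa(\omega)$ or $\kappa(\omega)=\omega^{-1/2}\tilde\kappa(\omega)$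 for all $\omega>0$ with some $\tilde\kappa\in C^3([0,\infty))$ whose derivatives of order $0,\dots,3$ are bounded. For $\alpha>0$, $\omega>0$ and $\Sigma\in\mathbb S^2$ let $G(\omega,\Sigma)$ be the operator of multiplication by $x\mapsto\kappa(\omega)e^{i\omega\Sigma\cdot x}\chi(\alpha x)$ on $L^2(\mathbb R^3)$. For $\epsilon,\beta>0$ set \[ F^{(1)}_\epsilon=\int_0^\infty\!\!\int_{\mathbb S^2}\frac{\omega^2}{e^{\beta\omega}-1}\,G(\omega,\Sigma)\frac{\epsilon P_{\rm ess}}{(H-E-\omega)^2+\epsilon^2}G(\omega,\Sigma)^*\,d\Sigma\,d\omega, \] \[ F^{(2)}_\epsilon=\int_0^\infty\!\!\int_{\mathbb S^2}\frac{\omega^2}{1-e^{-\beta\omega}}\,G(\omega,\Sigma)^*\frac{\epsilon P_{\rm ess}}{(H-E+\omega)^2+\epsilon^2}G(\omega,\Sigma)\,d\Sigma\,d\omega . \] Then for every $\epsilon>0$ there exist $\alpha>0$ and $\gamma>0$, independent of $\beta$, such that for all $\beta>0$ both integrals converge (as Bochner integrals in operator norm), \[ p_E F^{(2)}_\epsilon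 p_E\ \ge\ \gamma\,p_E ,\qquad p_E F^{(2)}_\epsilon p_E=\langle\phi_E,F^{(2)}_\epsilon\phi_E\rangle\,p_E\ \text{ for every normalized eigenvector } \phi_E \text{ of } H \text{ to the eigenvalue } E, \] and the Fermi Golden Rule condition holds with the same constant $\gamma$ for all $\beta>0$: for every $E'\in\sigma_d(H)$ (that is, for $E'=E$), \[ p_{E'}\bigl(F^{(1)}_\epsilon+F^{(2)}_\epsilon\bigr)p_{E'}\ \ge\ \gamma\,p_{E'} . \] -/

import Mathlib

open MeasureTheory Set Filter Topology
open scoped ENNReal SchwartzMap InnerProductSpace Laplacian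

noncomputable section

namespace ThermalIonization

/-- Physical space `ℝ³`. -/
abbrev Space : Type := EuclideanSpace ℝ (Fin 3)

/-- The unit sphere `𝕊²` of directions. -/
abbrev Dir : Type := Metric.sphere (0 : Space) 1

/-- The particle Hilbert space `L²(ℝ³; ℂ)`. -/
abbrev Hil : Type := Lp ℂ 2 (volume : Measure Space)

/-- The bounded operators on `L²(ℝ³; ℂ)`. The relation `≤` between them is the usual order
of quadratic forms. -/
abbrev BddOp : Type := Hil →L[ℂ] Hil

/-! ### The Schrödinger operator -/

/-- An `L²` function, viewed as a tempered distribution. -/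
def distr : Hil →ₗ[ℂ] 𝓢'(Space, ℂ) :=
  (Lp.toTemperedDistributionCLM ℂ (volume : Measure Space) 2).toLinearMap

theorem distr_injective : Function.Injective distr :=
  LinearMap.ker_eq_bot.mp (Lp.ker_toTemperedDistributionCLM_eq_bot (F := ℂ)
    (μ := (volume : Measure Space)) (p := 2))

/-- The Sobolev space `H²(ℝ³)`, as a subspace of `L²(ℝ³)`. -/
def sobolevTwo : Submodule ℂ Hil where
  carrier := {f | TemperedDistribution.MemSobolev 2 2 (distr f)}
  add_mem' := by
    intro f g hf hg
    change TemperedDistribution.MemSobolev 2 2 (distr (f + g))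
    rw [map_add]
    exact TemperedDistribution.MemSobolev.add hf hg
  zero_mem' := by
    change TemperedDistribution.MemSobolev 2 2 (distr 0)
    rw [map_zero]
    exact TemperedDistribution.memSobolev_fun_zero Space ℂ 2 2
  smul_mem' := by
    intro c f hf
    change TemperedDistribution.MemSobolev 2 2 (distr (c • f))
    rw [map_smul]
    exact TemperedDistribution.MemSobolev.smul c hf

theorem exists_laplacian (f : sobolevTwo) : ∃ g : Hil, distr g = Δ (distr f) := by
  have h := TemperedDistribution.MemSobolev.laplacian f.2
  rw [sub_self, TemperedDistribution.memSobolev_zero_iff] at h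
  obtain ⟨g, hg⟩ := h
  exact ⟨g, hg.symm⟩

/-- The distributional Laplacian `Δ : H²(ℝ³) → L²(ℝ³)`. -/
def lapl : sobolevTwo →ₗ[ℂ] Hil where
  toFun f := (exists_laplacian f).choose
  map_add' f g := by
    apply distr_injective
    rw [map_add, (exists_laplacian f).choose_spec, (exists_laplacian g).choose_spec,
      (exists_laplacian (f + g)).choose_spec, Submodule.coe_add, map_add]
    simp only [← TemperedDistribution.laplacianCLM_apply, map_add]
  map_smul' c f := by
    apply distr_injective
    rw [map_smul, (exists_laplacian f).choose_spec, (exists_laplacian (c • f)).choose_spec,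
      Submodule.coe_smul, map_smul]
    simp only [← TemperedDistribution.laplacianCLM_apply, map_smul, RingHom.id_apply]

theorem distr_lapl (f : sobolevTwo) : distr (lapl f) = Δ (distr f) :=
  (exists_laplacian f).choose_spec

open Classical in
/-- The operator of multiplication by an essentially bounded measurable function `m`
(`0` by convention for all other `m`). -/
def mulOp (m : Space → ℂ) : BddOp :=
  if h : MemLp m ∞ volume then
    (ContinuousLinearMap.mul ℂ ℂ).holderL volume ∞ 2 2 h.toLp
  else 0

theorem mulOp_coeFn {m : Space → ℂ} (h : MemLp m ∞ volume) (f : Hil) :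
    mulOp m f =ᵐ[volume] fun x => m x * f x := by
  rw [mulOp, dif_pos h]
  filter_upwards [(ContinuousLinearMap.mul ℂ ℂ).coeFn_holder (r := 2) (h.toLp) f, h.coeFn_toLp]
    with x hx hm
  refine hx.trans ?_
  rw [hm]
  rfl

/-- The Schrödinger operator `-Δ + V` in `L²(ℝ³)` with domain `H²(ℝ³)`. -/
def schrodinger (V : Space → ℝ) : Hil →ₗ.[ℂ] Hil where
  domain := sobolevTwo
  toFun := -lapl + (mulOp (fun x => (V x : ℂ))).toLinearMap ∘ₗ sobolevTwo.subtype

/-! ### Spectral notions for an operator `A` in `L²(ℝ³)` -/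

/-- The operator `A - z`, with the same domain as `A`. -/
def shift (A : Hil →ₗ.[ℂ] Hil) (z : ℂ) : Hil →ₗ.[ℂ] Hil where
  domain := A.domain
  toFun := A.toFun - z • A.domain.subtype

/-- The resolvent set of `A`: the `z` for which `A - z` has an everywhere defined bounded
inverse `R`. -/
def resolventSet (A : Hil →ₗ.[ℂ] Hil) : Set ℂ :=
  {z | ∃ R : BddOp, ∀ f g : Hil, R g = f ↔ ∃ hf : f ∈ (shift A z).domain, shift A z ⟨f, hf⟩ = g}

/-- The eigenspace `ker (A - z)`. -/
def eigenspace (A : Hil →ₗ.[ℂ] Hil) (z : ℂ) : Submodule ℂ Hil :=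
  (LinearMap.ker (shift A z).toFun).map (shift A z).domain.subtype

/-- The discrete spectrum (of a self-adjoint `A`): the isolated points of the spectrum which are
eigenvalues of finite multiplicity. -/
def discreteSpectrum (A : Hil →ₗ.[ℂ] Hil) : Set ℝ :=
  {E | eigenspace A E ≠ ⊥ ∧ FiniteDimensional ℂ (eigenspace A E) ∧
    ∃ δ > 0, ∀ z : ℂ, z ≠ E → ‖z - E‖ < δ → z ∈ resolventSet A}

/-- The spectral projection `p_E` of `A` corresponding to the eigenvalue `E`: the orthogonal
projection onto the (closed) eigenspace. -/
def eigenProj (A : Hil →ₗ.[ℂ] Hil) (E : ℝ) : BddOp :=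
  (eigenspace A E).topologicalClosure.starProjection

/-- The spectral projection `P_disc` to the discrete spectrum of `A`: the orthogonal projection
onto the closed span of all the eigenspaces that belong to it. -/
def discProj (A : Hil →ₗ.[ℂ] Hil) : BddOp :=
  (⨆ E ∈ discreteSpectrum A, eigenspace A (E : ℂ)).topologicalClosure.starProjection

/-- The spectral projection `P_ess = 1 - P_disc` to the essential spectrum of `A`. -/
def essProj (A : Hil →ₗ.[ℂ] Hil) : BddOp := 1 - discProj A

/-- `B` is the everywhere defined bounded inverse of `(A - e)² + ε²`. -/
def IsInverseSqAdd (A : Hil →ₗ.[ℂ] Hil) (e ε : ℝ) (B : BddOp) : Prop :=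
  ∀ f g : Hil, B g = f ↔
    ∃ (hf : f ∈ (shift A e).domain) (hf' : shift A e ⟨f, hf⟩ ∈ (shift A e).domain),
      shift A e ⟨shift A e ⟨f, hf⟩, hf'⟩ + ((ε ^ 2 : ℝ) : ℂ) • f = g

open Classical in
/-- The bounded operator `((A - e)² + ε²)⁻¹` (`0` by convention if there is no such inverse). -/
def inverseSqAdd (A : Hil →ₗ.[ℂ] Hil) (e ε : ℝ) : BddOp :=
  if h : ∃ B, IsInverseSqAdd A e ε B then h.choose else 0

/-- The operator `ε P_ess / ((A - e)² + ε²)`. -/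
def lorentz (A : Hil →ₗ.[ℂ] Hil) (e ε : ℝ) : BddOp :=
  (ε : ℂ) • (essProj A ∘L inverseSqAdd A e ε)

/-! ### The level shift operators and the Fermi Golden Rule condition -/

/-- The measure `dω dΣ` on `(0, ∞) × 𝕊²`, where `dΣ` is the surface measure of `𝕊²`. -/
def modeMeasure : Measure (ℝ × Dir) :=
  ((volume : Measure ℝ).restrict (Ioi 0)).prod (volume : Measure Space).toSphere

/-- The integrand of `F⁽¹⁾_ε` at `(ω, Σ)`. -/
def integrandOne (A : Hil →ₗ.[ℂ] Hil) (G : ℝ × Dir → BddOp) (β ε E : ℝ) (k : ℝ × Dir) : BddOp :=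
  ((k.1 ^ 2 / (Real.exp (β * k.1) - 1) : ℝ) : ℂ) •
    (G k ∘L lorentz A (E + k.1) ε ∘L (G k).adjoint)

/-- The integrand of `F⁽²⁾_ε` at `(ω, Σ)`. -/
def integrandTwo (A : Hil →ₗ.[ℂ] Hil) (G : ℝ × Dir → BddOp) (β ε E : ℝ) (k : ℝ × Dir) : BddOp :=
  ((k.1 ^ 2 / (1 - Real.exp (-(β * k.1))) : ℝ) : ℂ) •
    ((G k).adjoint ∘L lorentz A (E - k.1) ε ∘L G k)

/-- `F⁽¹⁾_ε = ∫ ω² / (e^{βω} - 1) G(ω,Σ) (ε P_ess / ((A - E - ω)² + ε²)) G(ω,Σ)^* dΣ dω`. -/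
def levelShiftOne (A : Hil →ₗ.[ℂ] Hil) (G : ℝ × Dir → BddOp) (β ε E : ℝ) : BddOp :=
  ∫ k, integrandOne A G β ε E k ∂modeMeasure

/-- `F⁽²⁾_ε = ∫ ω² / (1 - e^{-βω}) G(ω,Σ)^* (ε P_ess / ((A - E + ω)² + ε²)) G(ω,Σ) dΣ dω`. -/
def levelShiftTwo (A : Hil →ₗ.[ℂ] Hil) (G : ℝ × Dir → BddOp) (β ε E : ℝ) : BddOp :=
  ∫ k, integrandTwo A G β ε E k ∂modeMeasure

/-- The Fermi Golden Rule condition with constant `γ` at inverse temperature `β`: for every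
`E` in the discrete spectrum, `F⁽¹⁾_ε` and `F⁽²⁾_ε` exist as norm convergent integrals and
`p_E (F⁽¹⁾_ε + F⁽²⁾_ε) p_E ≥ γ p_E`. -/
def FermiGoldenRule (A : Hil →ₗ.[ℂ] Hil) (G : ℝ × Dir → BddOp) (β ε γ : ℝ) : Prop :=
  0 < γ ∧ ∀ E ∈ discreteSpectrum A,
    Integrable (integrandOne A G β ε E) modeMeasure ∧
    Integrable (integrandTwo A G β ε E) modeMeasure ∧
    (γ : ℂ) • eigenProj A E ≤
      eigenProj A E ∘L (levelShiftOne A G β ε E + levelShiftTwo A G β ε E) ∘L eigenProj A E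

/-! ### The coupling -/

/-- The function `x ↦ κ(ω) e^{i ω Σ·x} χ(α x)`. -/
def couplingFun (κ : ℝ → ℂ) (χ : 𝓢(Space, ℂ)) (α : ℝ) (k : ℝ × Dir) (x : Space) : ℂ :=
  κ k.1 * Complex.exp (Complex.I * ((k.1 * ⟪(k.2 : Space), x⟫_ℝ : ℝ) : ℂ)) * χ (α • x)

/-- `G(ω, Σ)`: the multiplication operator by `x ↦ κ(ω) e^{i ω Σ·x} χ(α x)`. -/
def coupling (κ : ℝ → ℂ) (χ : 𝓢(Space, ℂ)) (α : ℝ) (k : ℝ × Dir) : BddOp :=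
  mulOp (couplingFun κ χ α k)

/-- Ultraviolet cutoff: `κ` decays faster than any polynomial. -/
def UVCutoff (κ : ℝ → ℂ) : Prop :=
  ∀ n : ℕ, ∃ C : ℝ, ∀ ω : ℝ, 1 ≤ ω → ω ^ n * ‖κ ω‖ ≤ C

/-- Infrared behavior: `κ` is `C³` on `(0, ∞)`, and either `|∂^j κ(ω)| ≤ k₂ ω^{p - j}` for
`0 < ω < k₁`, `j ≤ 3`, with some `p > 2`, or `κ(ω) = ω^{±1/2} κ'(ω)` where `κ'` is `C³` on
`[0, ∞)` with bounded derivatives. -/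
def InfraredBehavior (κ : ℝ → ℂ) : Prop :=
  ContDiffOn ℝ 3 κ (Ioi 0) ∧
    ((∃ k₁ k₂ p : ℝ, 0 < k₁ ∧ 0 < k₂ ∧ 2 < p ∧ ∀ j : ℕ, j ≤ 3 → ∀ ω : ℝ, 0 < ω → ω < k₁ →
        ‖iteratedDerivWithin j κ (Ioi 0) ω‖ ≤ k₂ * ω ^ (p - (j : ℝ))) ∨
      ∃ (s : ℝ) (κ' : ℝ → ℂ), (s = 1 / 2 ∨ s = -(1 / 2)) ∧ ContDiffOn ℝ 3 κ' (Ici 0) ∧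
        (∀ j : ℕ, j ≤ 3 → ∃ C : ℝ, ∀ ω : ℝ, 0 ≤ ω → ‖iteratedDerivWithin j κ' (Ici 0) ω‖ ≤ C) ∧
        ∀ ω : ℝ, 0 < ω → κ ω = ((ω ^ s : ℝ) : ℂ) * κ' ω)

end ThermalIonization

end

noncomputable section

namespace ThermalIonization

open FourierTransform TemperedDistribution

/-! ### Multiplication operators -/

/-! Since `E` is simple with unit eigenvector `φ`, every compression `p T p` equals `⟪φ, T φ⟫ p`, so
only scalars have to be bounded from below. If `S(e)* S(e)` is the inverse of `(H - e)² + ε²`, then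
`⟪φ, F⁽²⁾ φ⟫` is the integral of the thermal weight times `ε ‖S(E - ω) P_ess G φ‖²`. The weight
equals `ω²` plus a nonnegative Bose term, so the integral dominates its zero temperature value,
which does not depend on `β`; that value is `γ`. The term from `F⁽¹⁾` is nonnegative.

It remains to see that `γ > 0`. As `S` is injective, the integrand can vanish at a mode with `ω > 0`
and `κ(ω) ≠ 0` only if `G φ` is a multiple of `φ`. For small `α` the region where `χ(α x) = c` meets
`{φ ≠ 0}` in positive measure, and there the plane wave would be constant, although its level sets
are null (`coupling_apply_ne_smul`, `exists_scale`). The modes with `κ(ω) ≠ 0` have positive measure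
by continuity.

The analytic input is a bounded self-adjoint inverse of `H + μ`
(`exists_isShiftInverse_schrodinger`), from which `exists_factor` builds a norm continuous, bounded
`S`. With norm continuity of `G` and the form factor bound this gives Bochner integrability
(`integrable_weighted`). -/

theorem memLp_top_of_norm_le {m : Space → ℂ} (hm : AEStronglyMeasurable m volume) {C : ℝ}
    (hC : ∀ x, ‖m x‖ ≤ C) : MemLp m ∞ volume :=
  memLp_top_of_bound hm C (Eventually.of_forall hC)

theorem norm_mulOp_le {m : Space → ℂ} {C : ℝ} (hC : ∀ x, ‖m x‖ ≤ C) : ‖mulOp m‖ ≤ C := by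
  have hC0 : 0 ≤ C := (norm_nonneg _).trans (hC 0)
  by_cases h : MemLp m ∞ volume
  · refine ContinuousLinearMap.opNorm_le_bound _ hC0 fun f => ?_
    refine Lp.norm_le_mul_norm_of_ae_le_mul ?_
    filter_upwards [mulOp_coeFn h f] with x hx
    rw [hx, norm_mul]
    exact mul_le_mul_of_nonneg_right (hC x) (norm_nonneg _)
  · rw [mulOp, dif_neg h, norm_zero]
    exact hC0

theorem mulOp_sub {m n : Space → ℂ} (hm : MemLp m ∞ volume) (hn : MemLp n ∞ volume) :
    mulOp m - mulOp n = mulOp (m - n) := by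
  refine ContinuousLinearMap.ext fun f => Lp.ext ?_
  rw [sub_apply]
  filter_upwards [mulOp_coeFn hm f, mulOp_coeFn hn f, mulOp_coeFn (hm.sub hn) f,
    Lp.coeFn_sub (mulOp m f) (mulOp n f)] with x h1 h2 h3 h4
  rw [h4, h3, Pi.sub_apply, h1, h2, Pi.sub_apply, sub_mul]

theorem inner_mulOp_left {m : Space → ℂ} (hm : MemLp m ∞ volume) (f g : Hil) :
    ⟪mulOp m f, g⟫_ℂ = ⟪f, mulOp (fun x => (starRingEnd ℂ) (m x)) g⟫_ℂ := by
  rw [L2.inner_def, L2.inner_def]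
  refine integral_congr_ae ?_
  filter_upwards [mulOp_coeFn hm f, mulOp_coeFn hm.star g] with x h1 h2
  change inner ℂ _ _ = inner ℂ _ ((mulOp (star m) g : Hil) x)
  rw [h1, h2]
  simp only [RCLike.inner_apply, map_mul, Pi.star_apply, RCLike.star_def]
  ring

theorem mulOp_isSelfAdjoint {m : Space → ℝ} (hm : MemLp (fun x => (m x : ℂ)) ∞ volume) :
    IsSelfAdjoint (mulOp fun x => (m x : ℂ)) := by
  rw [ContinuousLinearMap.isSelfAdjoint_iff_isSymmetric]
  intro f g
  refine (inner_mulOp_left hm f g).trans ?_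
  simp only [Complex.conj_ofReal]
  rfl

/-! ### Fourier multipliers on `L²` -/

/-- The Fourier multiplier `𝓕⁻¹ m 𝓕` on `L²`. -/
def fourierMul (m : Space → ℂ) : BddOp :=
  ((Lp.fourierTransformₗᵢ Space ℂ).symm : Hil →L[ℂ] Hil) ∘L mulOp m ∘L
    (Lp.fourierTransformₗᵢ Space ℂ : Hil →L[ℂ] Hil)

theorem fourierMul_apply (m : Space → ℂ) (f : Hil) : fourierMul m f = 𝓕⁻ (mulOp m (𝓕 f)) := rfl

theorem norm_fourierMul_le {m : Space → ℂ} {C : ℝ} (hC : ∀ x, ‖m x‖ ≤ C) :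
    ‖fourierMul m‖ ≤ C := by
  refine ContinuousLinearMap.opNorm_le_bound _ ((norm_nonneg _).trans (hC 0)) fun f => ?_
  have h : ‖fourierMul m f‖ = ‖mulOp m (𝓕 f)‖ :=
    (Lp.fourierTransformₗᵢ Space ℂ).symm.norm_map _
  rw [h, ← Lp.norm_fourier_eq f]
  exact (mulOp m).le_of_opNorm_le (norm_mulOp_le hC) _

theorem fourierMul_isSelfAdjoint {m : Space → ℝ} (hm : MemLp (fun x => (m x : ℂ)) ∞ volume) :
    IsSelfAdjoint (fourierMul fun x => (m x : ℂ)) := by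
  rw [ContinuousLinearMap.isSelfAdjoint_iff_isSymmetric]
  intro f g
  have h := (ContinuousLinearMap.isSelfAdjoint_iff_isSymmetric.mp (mulOp_isSelfAdjoint hm))
    (𝓕 f) (𝓕 g)
  change ⟪fourierMul _ f, g⟫_ℂ = ⟪f, fourierMul _ g⟫_ℂ
  rw [← Lp.inner_fourier_eq, ← Lp.inner_fourier_eq f, fourierMul_apply, fourierMul_apply,
    fourier_fourierInv_eq, fourier_fourierInv_eq]
  exact h

theorem distr_mulOp {m : Space → ℂ} (hm : m.HasTemperateGrowth) (hb : MemLp m ∞ volume)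
    (f : Hil) : distr (mulOp m f) = smulLeftCLM ℂ m (distr f) := by
  refine Eq.trans ?_ (Lp.toTemperedDistribution_smul_eq (r := 2) hm hb f)
  change Lp.toTemperedDistribution _ = _
  congr 1
  refine Lp.ext ?_
  filter_upwards [mulOp_coeFn hb f, Lp.coeFn_lpSMul (r := 2) (hb.toLp _) f, hb.coeFn_toLp]
    with x h1 h2 h3
  rw [h1, h2, Pi.smul_apply', h3, smul_eq_mul]

/-- Norm bounds and self-adjointness live on `L²`, while `sobolevTwo` and `lapl` are defined through
distributions; this identity connects the two. -/
theorem distr_fourierMul {m : Space → ℂ} (hm : m.HasTemperateGrowth) (hb : MemLp m ∞ volume)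
    (f : Hil) : distr (fourierMul m f) = fourierMultiplierCLM ℂ m (distr f) := by
  rw [fourierMultiplierCLM_apply, fourierMul_apply]
  have h1 : 𝓕 (distr f) = distr (𝓕 f) := Lp.fourier_toTemperedDistribution_eq f
  have h2 : 𝓕⁻ (distr (mulOp m (𝓕 f))) = distr (𝓕⁻ (mulOp m (𝓕 f))) :=
    Lp.fourierInv_toTemperedDistribution_eq _
  rw [h1, ← distr_mulOp hm hb, h2]

/-! ### The resolvent of the free Laplacian -/

/-- The symbol of `-Δ + μ`. -/
def freeSymbol (μ : ℝ) (x : Space) : ℝ := (2 * Real.pi) ^ 2 * ‖x‖ ^ 2 + μ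

theorem freeSymbol_pos {μ : ℝ} (hμ : 0 < μ) (x : Space) : 0 < freeSymbol μ x := by
  unfold freeSymbol; positivity

theorem freeSymbol_hasTemperateGrowth (μ : ℝ) :
    (fun x => (freeSymbol μ x : ℂ)).HasTemperateGrowth := by
  unfold freeSymbol
  fun_prop

theorem freeSymbol_inv_hasTemperateGrowth {μ : ℝ} (hμ : 0 < μ) :
    (fun x => (((freeSymbol μ x)⁻¹ : ℝ) : ℂ)).HasTemperateGrowth := by
  -- Scaling by `2π/√μ` turns the inverse symbol into `μ⁻¹ (1 + ‖y‖²)⁻¹`, a known function of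
  -- temperate growth.
  have h1 : (fun x : Space =>
      (1 + ‖(2 * Real.pi * (√μ)⁻¹) • x‖ ^ 2) ^ (-1 : ℝ)).HasTemperateGrowth :=
    (Function.hasTemperateGrowth_one_add_norm_sq_rpow Space (-1)).comp
      (((2 * Real.pi * (√μ)⁻¹) • ContinuousLinearMap.id ℝ Space).hasTemperateGrowth)
  have h2 : (fun x : Space =>
      μ⁻¹ * (1 + ‖(2 * Real.pi * (√μ)⁻¹) • x‖ ^ 2) ^ (-1 : ℝ)).HasTemperateGrowth :=
    (Function.HasTemperateGrowth.const μ⁻¹).mul h1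
  have h3 : (fun x : Space => (freeSymbol μ x)⁻¹) =
      fun x : Space => μ⁻¹ * (1 + ‖(2 * Real.pi * (√μ)⁻¹) • x‖ ^ 2) ^ (-1 : ℝ) := by
    ext x
    rw [Real.rpow_neg_one, ← mul_inv, norm_smul, mul_pow, Real.norm_eq_abs, sq_abs, mul_pow,
      inv_pow, Real.sq_sqrt hμ.le, freeSymbol]
    congr 1
    field_simp
    ring
  have h4 := h3 ▸ h2
  fun_prop

theorem norm_freeSymbol_inv_le {μ : ℝ} (hμ : 0 < μ) (x : Space) :
    ‖(((freeSymbol μ x)⁻¹ : ℝ) : ℂ)‖ ≤ μ⁻¹ := by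
  rw [Complex.norm_real, Real.norm_eq_abs, abs_of_pos (inv_pos.2 (freeSymbol_pos hμ x))]
  refine inv_anti₀ hμ ?_
  unfold freeSymbol
  linarith [show 0 ≤ (2 * Real.pi) ^ 2 * ‖x‖ ^ 2 by positivity]

theorem memLp_freeSymbol_inv {μ : ℝ} (hμ : 0 < μ) :
    MemLp (fun x : Space => (((freeSymbol μ x)⁻¹ : ℝ) : ℂ)) ∞ volume :=
  memLp_top_of_norm_le
    (freeSymbol_inv_hasTemperateGrowth hμ).1.continuous.aestronglyMeasurable
    (norm_freeSymbol_inv_le hμ)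

/-- The operator `(-Δ + μ)⁻¹` on `L²`. -/
def freeResolvent (μ : ℝ) : BddOp := fourierMul fun x => (((freeSymbol μ x)⁻¹ : ℝ) : ℂ)

theorem neg_laplacian_add_eq (μ : ℝ) (u : 𝓢'(Space, ℂ)) :
    -Δ u + (μ : ℂ) • u = fourierMultiplierCLM ℂ (fun x => (freeSymbol μ x : ℂ)) u := by
  have h1 : (fun x : Space => (freeSymbol μ x : ℂ)) =
      fun x => ∑ i : Fin 2, (![((2 * Real.pi) ^ 2 : ℂ) • (fun x : Space => ((‖x‖ ^ 2 : ℝ) : ℂ)),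
        fun _ => (μ : ℂ)] i) x := by
    ext x
    simp [freeSymbol]
  have h0 : (fun x : Space => ((‖x‖ ^ 2 : ℝ) : ℂ)).HasTemperateGrowth := by fun_prop
  have h2 : (((2 * Real.pi) ^ 2 : ℂ) • (fun x : Space => ((‖x‖ ^ 2 : ℝ) : ℂ))).HasTemperateGrowth :=
    (Function.HasTemperateGrowth.const (((2 * Real.pi) ^ 2 : ℂ))).mul h0
  rw [h1, fourierMultiplierCLM_sum ℂ]
  · rw [Fin.sum_univ_two]
    simp only [Matrix.cons_val_zero, Matrix.cons_val_one]
    rw [fourierMultiplierCLM_smul h0, fourierMultiplierCLM_const, laplacian_eq_fourierMultiplierCLM,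
      add_apply, smul_apply, smul_apply, ContinuousLinearMap.id_apply, neg_smul, neg_neg,
      ← Complex.coe_smul]
    push_cast
    rfl
  · intro i _
    fin_cases i
    · exact h2
    · exact Function.HasTemperateGrowth.const (μ : ℂ)

/-- On distributions the multipliers with symbol and inverse symbol cancel. What remains is
regularity: for `u` the image of `g`, `Δ u = μ u - g` is again in `L²`, which puts `u` in `H²`. -/
theorem freeResolvent_eq_iff {μ : ℝ} (hμ : 0 < μ) (f g : Hil) :
    freeResolvent μ g = f ↔ ∃ hf : f ∈ sobolevTwo, -lapl ⟨f, hf⟩ + (μ : ℂ) • f = g := by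
  have hT := freeSymbol_hasTemperateGrowth μ
  have hI := freeSymbol_inv_hasTemperateGrowth hμ
  have hB := memLp_freeSymbol_inv hμ
  have h1 : ((fun x : Space => (((freeSymbol μ x)⁻¹ : ℝ) : ℂ)) * fun x => (freeSymbol μ x : ℂ)) =
      fun _ => 1 := by
    ext x
    simp only [Pi.mul_apply]
    rw [← Complex.ofReal_mul, inv_mul_cancel₀ (freeSymbol_pos hμ x).ne', Complex.ofReal_one]
  have key : ∀ u v : 𝓢'(Space, ℂ),
      fourierMultiplierCLM ℂ (fun x : Space => (((freeSymbol μ x)⁻¹ : ℝ) : ℂ)) v = u ↔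
        -Δ u + (μ : ℂ) • u = v := by
    intro u v
    rw [neg_laplacian_add_eq]
    constructor
    · rintro rfl
      rw [fourierMultiplierCLM_fourierMultiplierCLM_apply hI hT, h1]
      simp
    · rintro rfl
      rw [fourierMultiplierCLM_fourierMultiplierCLM_apply hT hI, mul_comm, h1]
      simp
  have hdom : ∀ g : Hil, freeResolvent μ g ∈ sobolevTwo := by
    intro g
    change MemSobolev 2 2 (distr (fourierMul _ g))
    rw [distr_fourierMul hI hB]
    set u : 𝓢'(Space, ℂ) := fourierMultiplierCLM ℂ (fun x : Space => (((freeSymbol μ x)⁻¹ : ℝ) : ℂ))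
      (distr g)
    have hL2 : MemSobolev 0 2 u := by
      refine ⟨freeResolvent μ g, ?_⟩
      rw [besselPotential_zero]
      exact (distr_fourierMul hI hB g).symm
    have hu : -Δ u + (μ : ℂ) • u = distr g := (key u (distr g)).1 rfl
    have hg : MemSobolev 0 2 (distr g) := ⟨g, by rw [besselPotential_zero]; rfl⟩
    have hlap : MemSobolev 0 2 (Δ u) := by
      have : Δ u = (μ : ℂ) • u - distr g := by rw [← hu]; abel
      rw [this]
      exact (hL2.smul _).sub hg
    -- The Bessel potential of order 2 has symbol `1 + ‖x‖²`, which is `(2π)⁻²` times the symbol of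
    -- `-Δ + (2π)²`.
    have h3 : besselPotential Space ℂ 2 u =
        (((2 * Real.pi) ^ 2)⁻¹ : ℂ) • (-Δ u + ((2 * Real.pi) ^ 2 : ℂ) • u) := by
      have := neg_laplacian_add_eq ((2 * Real.pi) ^ 2) u
      push_cast at this
      rw [this, besselPotential, ← smul_apply, ← fourierMultiplierCLM_smul
        (freeSymbol_hasTemperateGrowth _)]
      congr 2
      ext x
      simp [freeSymbol]
      field_simp
      ring
    have h4 : MemSobolev 0 2 (besselPotential Space ℂ 2 u) := by
      rw [h3]
      exact (hlap.neg.add (hL2.smul _)).smul _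
    simpa using h4
  constructor
  · rintro rfl
    refine ⟨hdom g, distr_injective ?_⟩
    rw [map_add, map_neg, map_smul, distr_lapl]
    refine (key _ _).1 ?_
    exact (distr_fourierMul hI hB g).symm
  · rintro ⟨hf, rfl⟩
    apply distr_injective
    refine (distr_fourierMul hI hB _).trans ((key _ _).2 ?_)
    rw [map_add, map_neg, map_smul, distr_lapl]

theorem norm_freeResolvent_le {μ : ℝ} (hμ : 0 < μ) : ‖freeResolvent μ‖ ≤ μ⁻¹ :=
  norm_fourierMul_le (norm_freeSymbol_inv_le hμ)

theorem freeResolvent_isSelfAdjoint {μ : ℝ} (hμ : 0 < μ) : IsSelfAdjoint (freeResolvent μ) :=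
  fourierMul_isSelfAdjoint (memLp_freeSymbol_inv hμ)

/-! ### The resolvent of the Schrödinger operator -/

/-- `R` is the everywhere defined bounded inverse of `A + μ`. -/
def IsShiftInverse (A : Hil →ₗ.[ℂ] Hil) (μ : ℝ) (R : BddOp) : Prop :=
  ∀ f g : Hil, R g = f ↔ ∃ hf : f ∈ A.domain, A ⟨f, hf⟩ + (μ : ℂ) • f = g

/-- With `μ = v + 1` one has `‖R₀ W‖ ≤ v / (v + 1) < 1`, so `U = 1 + R₀ W` is invertible by a
Neumann series and `H + μ = (-Δ + μ) U` has inverse `U⁻¹ R₀`. Its self-adjointness amounts to `U R₀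
= R₀ U*`. -/
theorem exists_isShiftInverse_schrodinger {V : Space → ℝ}
    (hV : MemLp (fun x => (V x : ℂ)) ∞ volume) {v : ℝ} (hv : ∀ x, ‖(V x : ℂ)‖ ≤ v) :
    ∃ (μ : ℝ) (R : BddOp), IsSelfAdjoint R ∧ IsShiftInverse (schrodinger V) μ R := by
  have hv0 : 0 ≤ v := (norm_nonneg _).trans (hv 0)
  set μ : ℝ := v + 1
  have hμ : 0 < μ := by positivity
  set W : BddOp := mulOp fun x => (V x : ℂ) with hWdef
  set R₀ := freeResolvent μ
  have hW : IsSelfAdjoint W := mulOp_isSelfAdjoint hV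
  have hR₀ : IsSelfAdjoint R₀ := freeResolvent_isSelfAdjoint hμ
  have hnorm : ‖-(R₀ * W)‖ < 1 := by
    rw [norm_neg]
    refine (norm_mul_le _ _).trans_lt ?_
    calc ‖R₀‖ * ‖W‖ ≤ μ⁻¹ * v := mul_le_mul (norm_freeResolvent_le hμ) (norm_mulOp_le hv)
          (norm_nonneg _) (by positivity)
      _ < 1 := by rw [inv_mul_lt_one₀ hμ]; exact lt_add_one v
  obtain ⟨U, hU⟩ : IsUnit (1 + R₀ * W) := by
    simpa using (Units.oneSub _ hnorm).isUnit
  have hstar : star (U : BddOp) = 1 + W * R₀ := by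
    rw [hU, star_add, star_one, star_mul, hR₀.star_eq, hW.star_eq]
  refine ⟨μ, ↑U⁻¹ * R₀, ?_, fun f g => ?_⟩
  · have hcomm : (U : BddOp) * R₀ = R₀ * star (U : BddOp) := by
      rw [hstar, hU, add_mul, mul_add, one_mul, mul_one, mul_assoc]
    rw [isSelfAdjoint_iff, star_mul, hR₀.star_eq, ← Units.coe_star_inv]
    rw [Units.eq_inv_mul_iff_mul_eq, ← mul_assoc, hcomm, mul_assoc, ← Units.coe_star,
      Units.mul_inv, mul_one]
  · have h1 : (↑U⁻¹ * R₀ : BddOp) g = f ↔ R₀ (g - W f) = f := by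
      have e1 : (↑U⁻¹ * R₀ : BddOp) g = f ↔ R₀ g = (U : BddOp) f := by
        constructor
        · rintro rfl
          change _ = ((U : BddOp) * (↑U⁻¹ * R₀)) g
          rw [Units.mul_inv_cancel_left]
        · intro h
          change (↑U⁻¹ : BddOp) (R₀ g) = f
          rw [h]
          change ((↑U⁻¹ : BddOp) * U) f = f
          rw [Units.inv_mul]
          rfl
      rw [e1, hU, map_sub, sub_eq_iff_eq_add]
      rfl
    rw [h1, freeResolvent_eq_iff hμ]
    refine exists_congr fun hf => ?_
    have h2 : (schrodinger V) ⟨f, hf⟩ = -lapl ⟨f, hf⟩ + W f := rfl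
    rw [h2, eq_sub_iff_add_eq]
    constructor <;> (intro h; rw [← h]; abel)

/-! ### The operators `((A - e)² + ε²)⁻¹` -/

section Inverse

variable {A : Hil →ₗ.[ℂ] Hil} {μ : ℝ} {R : BddOp}

theorem IsShiftInverse.shift_apply (h : IsShiftInverse A μ R) (e : ℝ) (u : Hil) :
    ∃ hf : R u ∈ (shift A e).domain,
      shift A e ⟨R u, hf⟩ = u - ((μ + e : ℝ) : ℂ) • R u := by
  obtain ⟨hf, hu⟩ := (h (R u) u).1 rfl
  refine ⟨hf, ?_⟩
  change A ⟨R u, hf⟩ - (e : ℂ) • R u = _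
  rw [eq_sub_of_add_eq hu]
  push_cast
  module

theorem IsShiftInverse.exists_eq (h : IsShiftInverse A μ R) {f : Hil} (hf : f ∈ A.domain) :
    ∃ u, R u = f :=
  ⟨_, (h f _).2 ⟨hf, rfl⟩⟩

/-- Write `1 - z R = z (z⁻¹ - R)`: `z⁻¹` is not real, whereas the spectrum of a self-adjoint `R` is.
-/
theorem isUnit_one_sub_smul (hR : IsSelfAdjoint R) {z : ℂ} (hz : z.im ≠ 0) :
    IsUnit (1 - z • R) := by
  have hz0 : z ≠ 0 := by rintro rfl; exact hz rfl
  have h1 : z⁻¹ ∉ spectrum ℂ R := by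
    intro hmem
    have := hR.im_eq_zero_of_mem_spectrum hmem
    rw [Complex.inv_im, div_eq_zero_iff, neg_eq_zero, Complex.normSq_eq_zero] at this
    exact this.elim hz hz0
  rw [spectrum.notMem_iff] at h1
  have h2 : 1 - z • R = (Units.mk0 z hz0) • (algebraMap ℂ BddOp z⁻¹ - R) := by
    rw [smul_sub, Algebra.algebraMap_eq_smul_one]
    simp only [Units.smul_def, Units.val_mk0]
    rw [smul_inv_smul₀ hz0]
  rw [h2]
  exact h1.smul _

/-- The domain of `(A - e)²` is the range of `R²`, and `((A - e)² + ε²) R²` is a quadratic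
polynomial in `R`. The unbounded problem thus reduces to identities between bounded operators. -/
theorem isInverseSqAdd_of_mul_eq (h : IsShiftInverse A μ R) {e ε : ℝ} {B : BddOp}
    (h1 : ∀ g, ∃ u, B g = R (R u) ∧
      u - (2 * (μ + e) : ℂ) • R u + ((μ + e) ^ 2 + ε ^ 2 : ℂ) • R (R u) = g)
    (h2 : ∀ u, B (u - (2 * (μ + e) : ℂ) • R u + ((μ + e) ^ 2 + ε ^ 2 : ℂ) • R (R u)) = R (R u)) :
    IsInverseSqAdd A e ε B := by
  have key : ∀ u : Hil, ∃ (hf : R (R u) ∈ (shift A e).domain)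
      (hf' : shift A e ⟨R (R u), hf⟩ ∈ (shift A e).domain),
      shift A e ⟨shift A e ⟨R (R u), hf⟩, hf'⟩ + ((ε ^ 2 : ℝ) : ℂ) • R (R u) =
        u - (2 * (μ + e) : ℂ) • R u + ((μ + e) ^ 2 + ε ^ 2 : ℂ) • R (R u) := by
    intro u
    obtain ⟨hf, e1⟩ := h.shift_apply e (R u)
    obtain ⟨hg, e2⟩ := h.shift_apply e (u - ((μ + e : ℝ) : ℂ) • R u)
    have e3 : R (u - ((μ + e : ℝ) : ℂ) • R u) = shift A e ⟨R (R u), hf⟩ := by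
      rw [e1, map_sub, map_smul]
    have hf' : shift A e ⟨R (R u), hf⟩ ∈ (shift A e).domain := e3 ▸ hg
    refine ⟨hf, hf', ?_⟩
    have e4 : shift A e ⟨shift A e ⟨R (R u), hf⟩, hf'⟩ =
        shift A e ⟨R (u - ((μ + e : ℝ) : ℂ) • R u), hg⟩ := by
      congr 1
      exact Subtype.ext e3.symm
    rw [e4, e2, map_sub, map_smul]
    push_cast
    module
  intro f g
  constructor
  · rintro rfl
    obtain ⟨u, hu, rfl⟩ := h1 g
    rw [hu]
    exact key u
  · rintro ⟨hf, hf', rfl⟩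
    obtain ⟨u, rfl⟩ := h.exists_eq hf
    obtain ⟨v, hv⟩ := h.exists_eq hf'
    obtain ⟨_, e1⟩ := h.shift_apply e u
    rw [e1] at hv
    -- Since `(A - e) R u = u - (μ + e) R u` lies in the range of `R`, so does `u`.
    have e2 : u = R (v + ((μ + e : ℝ) : ℂ) • u) := by
      rw [map_add, map_smul, hv]; abel
    obtain ⟨w, hw⟩ : ∃ w, u = R w := ⟨_, e2⟩
    subst hw
    obtain ⟨_, _, e3⟩ := key w
    rw [e3]
    exact h2 w

/-- Take `S(e) = R (1 - z R)⁻¹` with `z = μ + e + iε`, which is the resolvent of `A` at `e + iε`.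
The product `(1 - z̄ R)(1 - z R)` is the quadratic polynomial of `isInverseSqAdd_of_mul_eq`. The
bound `ε⁻¹` comes from `Im ⟪R k, (1 - z R) k⟫ = -ε ‖R k‖²`. -/
theorem IsShiftInverse.exists_factor (h : IsShiftInverse A μ R) (hR : IsSelfAdjoint R) {ε : ℝ}
    (hε : 0 < ε) :
    ∃ S : ℝ → BddOp, Continuous S ∧ (∀ e, ‖S e‖ ≤ ε⁻¹) ∧
      ∀ e, IsInverseSqAdd A e ε (star (S e) * S e) := by
  let z : ℝ → ℂ := fun e => ((μ + e : ℝ) : ℂ) + (ε : ℂ) * Complex.I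
  have hz : ∀ e, (z e).im = ε := fun e => by simp [z]
  let T : ℝ → BddOp := fun e => 1 - z e • R
  have hT : ∀ e, IsUnit (T e) := fun e => isUnit_one_sub_smul hR (by rw [hz]; exact hε.ne')
  have hTc : Continuous T := by fun_prop
  have hcomm : ∀ e, Commute R (T e) := fun e =>
    (Commute.one_right R).sub_right ((Commute.refl R).smul_right _)
  refine ⟨fun e => R * Ring.inverse (T e), ?_, fun e => ?_, fun e => ?_⟩
  · refine continuous_const.mul (continuous_iff_continuousAt.2 fun e => ?_)
    obtain ⟨u, hu⟩ := hT e
    have := NormedRing.inverse_continuousAt u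
    rw [hu] at this
    exact ContinuousAt.comp (f := T) this hTc.continuousAt
  · refine ContinuousLinearMap.opNorm_le_bound _ (by positivity) fun g => ?_
    set k := Ring.inverse (T e) g
    have hg : g = T e k := by
      change g = (T e * Ring.inverse (T e)) g
      rw [Ring.mul_inverse_cancel _ (hT e)]; rfl
    change ‖R k‖ ≤ ε⁻¹ * ‖g‖
    have hsym := ContinuousLinearMap.isSelfAdjoint_iff_isSymmetric.mp hR
    have h1 : (⟪R k, k⟫_ℂ).im = 0 := by
      have := hsym.im_inner_apply_self k
      simpa using this
    have h2 : (⟪R k, g⟫_ℂ).im = -(ε * ‖R k‖ ^ 2) := by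
      rw [hg]
      change (⟪R k, k - z e • R k⟫_ℂ).im = _
      rw [inner_sub_right, inner_smul_right, inner_self_eq_norm_sq_to_K, Complex.sub_im, h1,
        ← hz e]
      simp [← Complex.ofReal_pow]
    have h3 : ε * ‖R k‖ ^ 2 ≤ ‖R k‖ * ‖g‖ := by
      calc ε * ‖R k‖ ^ 2 = |(⟪R k, g⟫_ℂ).im| := by
            rw [h2, abs_neg, abs_of_nonneg (by positivity)]
        _ ≤ ‖⟪R k, g⟫_ℂ‖ := Complex.abs_im_le_norm _
        _ ≤ _ := norm_inner_le_norm _ _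
    rw [le_inv_mul_iff₀ hε]
    rcases (norm_nonneg (R k)).eq_or_lt with h0 | h0
    · rw [← h0, mul_zero]; exact norm_nonneg _
    · refine le_of_mul_le_mul_left ?_ h0
      linarith
  · obtain ⟨u, hu⟩ := hT e
    simp only
    rw [← hu, Ring.inverse_unit]
    have hcu : Commute R (u : BddOp) := hu ▸ hcomm e
    have hcv : Commute R ((u⁻¹ : BddOpˣ) : BddOp) := hcu.units_inv_right
    have hstar : star (u : BddOp) = 1 - (starRingEnd ℂ (z e)) • R := by
      rw [hu, star_sub, star_one, star_smul, hR.star_eq]; rfl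
    have hprod : ∀ w : Hil, (star (u : BddOp) * u) w =
        w - (2 * (μ + e) : ℂ) • R w + ((μ + e) ^ 2 + ε ^ 2 : ℂ) • R (R w) := by
      intro w
      rw [hstar, hu]
      change (w - z e • R w) - (starRingEnd ℂ (z e)) • R (w - z e • R w) = _
      rw [map_sub, map_smul]
      have hz1 : z e + starRingEnd ℂ (z e) = 2 * (μ + e) := by
        simp [z]; ring
      have hz2 : starRingEnd ℂ (z e) * z e = (μ + e) ^ 2 + ε ^ 2 := by
        simp [z]; ring_nf; simp
      rw [← hz1, ← hz2]
      module
    have hB : star (R * (↑u⁻¹ : BddOp)) * (R * ↑u⁻¹) = R * R * (↑u⁻¹ * star (↑u⁻¹ : BddOp)) := by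
      have hcvs : Commute R (star ((u⁻¹ : BddOpˣ) : BddOp)) := by
        have := hcv.star_star
        rwa [hR.star_eq] at this
      have huu : Commute (star (u : BddOp)) (u : BddOp) := by
        rw [hstar]
        exact (Commute.one_left _).sub_left (hcu.smul_left _)
      have hvv : Commute (star ((u⁻¹ : BddOpˣ) : BddOp)) ((u⁻¹ : BddOpˣ) : BddOp) := by
        rw [← Units.coe_star_inv]
        rw [← Units.coe_star] at huu
        exact huu.units_inv_left.units_inv_right
      rw [star_mul, hR.star_eq]
      calc star (↑u⁻¹ : BddOp) * R * (R * ↑u⁻¹) = R * (star (↑u⁻¹ : BddOp) * R) * ↑u⁻¹ := by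
            rw [← mul_assoc, ← mul_assoc, ← hcvs.eq]
        _ = R * (R * star (↑u⁻¹ : BddOp)) * ↑u⁻¹ := by rw [hcvs.eq]
        _ = R * R * (star (↑u⁻¹ : BddOp) * ↑u⁻¹) := by simp only [mul_assoc]
        _ = _ := by rw [hvv.eq]
    have hinv1 : (↑u⁻¹ * star (↑u⁻¹ : BddOp)) * (star (u : BddOp) * u) = 1 := by
      rw [← Units.coe_star_inv, ← Units.coe_star, mul_assoc, Units.inv_mul_cancel_left,
        Units.inv_mul]
    have hinv2 : (star (u : BddOp) * u) * (↑u⁻¹ * star (↑u⁻¹ : BddOp)) = 1 := by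
      rw [← Units.coe_star_inv, ← Units.coe_star, mul_assoc, Units.mul_inv_cancel_left,
        Units.mul_inv]
    rw [hB]
    refine isInverseSqAdd_of_mul_eq h (fun g => ⟨(↑u⁻¹ * star (↑u⁻¹ : BddOp)) g, rfl, ?_⟩)
      fun w => ?_
    · rw [← hprod]
      change ((star (u : BddOp) * u) * (↑u⁻¹ * star (↑u⁻¹ : BddOp))) g = g
      rw [hinv2]; rfl
    · rw [← hprod]
      change R (R (((↑u⁻¹ * star (↑u⁻¹ : BddOp)) * (star (u : BddOp) * u)) w)) = _
      rw [hinv1]; rfl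

theorem inverseSqAdd_eq {e ε : ℝ} {B : BddOp} (hB : IsInverseSqAdd A e ε B) :
    inverseSqAdd A e ε = B := by
  have h : ∃ B, IsInverseSqAdd A e ε B := ⟨B, hB⟩
  rw [inverseSqAdd, dif_pos h]
  exact ContinuousLinearMap.ext fun g => (h.choose_spec _ _).2 ((hB _ _).1 rfl)

end Inverse

/-! ### Spectral projections at a simple eigenvalue -/

section Projection

variable {A : Hil →ₗ.[ℂ] Hil} {E : ℝ}

theorem mem_eigenspace_iff {z : ℂ} {f : Hil} :
    f ∈ eigenspace A z ↔ ∃ hf : f ∈ A.domain, A ⟨f, hf⟩ = z • f := by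
  constructor
  · rintro ⟨⟨f, hf⟩, hk, rfl⟩
    exact ⟨hf, sub_eq_zero.1 hk⟩
  · rintro ⟨hf, h⟩
    exact ⟨⟨f, hf⟩, sub_eq_zero.2 h, rfl⟩

theorem eigenspace_eq_span {z : ℂ} (h1 : Module.finrank ℂ (eigenspace A z) = 1) {φ : Hil}
    (hφ : φ ∈ eigenspace A z) (hn : ‖φ‖ = 1) : eigenspace A z = ℂ ∙ φ := by
  have hne : (⟨φ, hφ⟩ : eigenspace A z) ≠ 0 := by
    intro h
    rw [show φ = 0 from congrArg Subtype.val h, norm_zero] at hn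
    exact zero_ne_one hn
  refine le_antisymm (fun x hx => ?_) ((Submodule.span_singleton_le_iff_mem _ _).2 hφ)
  obtain ⟨c, hc⟩ := (finrank_eq_one_iff_of_nonzero' _ hne).1 h1 ⟨x, hx⟩
  exact Submodule.mem_span_singleton.2 ⟨c, congrArg Subtype.val hc⟩

theorem exists_unit_eigenvector {z : ℂ} (h1 : Module.finrank ℂ (eigenspace A z) = 1) :
    ∃ φ ∈ eigenspace A z, ‖φ‖ = 1 := by
  have : Nontrivial (eigenspace A z) := Module.nontrivial_of_finrank_pos (R := ℂ) (by omega)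
  obtain ⟨x, hx⟩ := exists_ne (0 : eigenspace A z)
  refine ⟨((‖x‖⁻¹ : ℝ) : ℂ) • (x : Hil), Submodule.smul_mem _ _ x.2, ?_⟩
  have := norm_pos_iff.2 hx
  rw [norm_smul, Complex.norm_real, norm_inv, norm_norm]
  exact inv_mul_cancel₀ this.ne'

theorem eigenProj_apply (h1 : Module.finrank ℂ (eigenspace A E) = 1) {φ : Hil}
    (hφ : φ ∈ eigenspace A E) (hn : ‖φ‖ = 1) (w : Hil) : eigenProj A E w = ⟪φ, w⟫_ℂ • φ := by
  have h2 : (eigenspace A E).topologicalClosure = ℂ ∙ φ := by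
    rw [eigenspace_eq_span h1 hφ hn]
    exact (Submodule.closed_of_finiteDimensional _).submodule_topologicalClosure_eq
  rw [← Submodule.starProjection_unit_singleton ℂ hn w]
  simp only [eigenProj, h2]

theorem discProj_eq (hd : discreteSpectrum A = {E}) : discProj A = eigenProj A E := by
  have h : ⨆ E' ∈ discreteSpectrum A, eigenspace A (E' : ℂ) = eigenspace A E := by
    rw [hd, iSup_singleton]
  simp only [discProj, eigenProj, h]

theorem essProj_apply (hd : discreteSpectrum A = {E})
    (h1 : Module.finrank ℂ (eigenspace A E) = 1) {φ : Hil}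
    (hφ : φ ∈ eigenspace A E) (hn : ‖φ‖ = 1) (w : Hil) : essProj A w = w - ⟪φ, w⟫_ℂ • φ := by
  rw [essProj, discProj_eq hd, ← eigenProj_apply h1 hφ hn]
  rfl

/-- Used to show that `B` commutes with `P_ess`. -/
theorem IsInverseSqAdd.apply_eigenvector {e ε : ℝ} {B : BddOp} (hB : IsInverseSqAdd A e ε B)
    (hε : 0 < ε) {φ : Hil} (hφ : φ ∈ eigenspace A E) :
    B φ = ((((E - e) ^ 2 + ε ^ 2)⁻¹ : ℝ) : ℂ) • φ := by
  obtain ⟨hf, h⟩ := mem_eigenspace_iff.1 hφ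
  have hs : shift A e ⟨φ, hf⟩ = ((E - e : ℝ) : ℂ) • φ := by
    change A ⟨φ, hf⟩ - (e : ℂ) • φ = _
    rw [h]; push_cast; module
  have hs' : ∀ hx : ((E - e : ℝ) : ℂ) • φ ∈ (shift A e).domain,
      shift A e ⟨((E - e : ℝ) : ℂ) • φ, hx⟩ = ((E - e : ℝ) : ℂ) • ((E - e : ℝ) : ℂ) • φ := by
    intro hx
    exact (LinearPMap.map_smul (shift A e) ((E - e : ℝ) : ℂ) ⟨φ, hf⟩).trans
      (congrArg (((E - e : ℝ) : ℂ) • ·) hs)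
  have hf' : shift A e ⟨φ, hf⟩ ∈ (shift A e).domain := hs ▸ A.domain.smul_mem _ hf
  have key := (hB φ _).2 ⟨hf, hf', rfl⟩
  have hs2 : shift A e ⟨shift A e ⟨φ, hf⟩, hf'⟩ =
      ((E - e : ℝ) : ℂ) • ((E - e : ℝ) : ℂ) • φ := by
    rw [← hs' (hs ▸ hf')]
    congr 1
    exact Subtype.ext hs
  have hd : (((E - e) ^ 2 + ε ^ 2 : ℝ) : ℂ) ≠ 0 := by
    rw [Complex.ofReal_ne_zero]; positivity
  rw [hs2, smul_smul, ← add_smul, map_smul] at key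
  rw [Complex.ofReal_inv, ← inv_smul_smul₀ hd (B φ)]
  congr 1
  refine Eq.trans ?_ key
  congr 1
  push_cast
  ring

theorem IsInverseSqAdd.injective {e ε : ℝ} {B : BddOp} (hB : IsInverseSqAdd A e ε B) {g : Hil}
    (hg : B g = 0) : g = 0 := by
  obtain ⟨hf, hf', h⟩ := (hB 0 g).1 hg
  have h0 : shift A e ⟨0, hf⟩ = 0 := (shift A e).map_zero
  have h1 : shift A e ⟨shift A e ⟨0, hf⟩, hf'⟩ = 0 :=
    (congrArg (shift A e) (Subtype.ext h0)).trans (shift A e).map_zero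
  rw [← h, h1, smul_zero, add_zero]

/-- `B = S* S` is symmetric with eigenvector `φ`, so it commutes with `P_ess`; the projection can
then be placed on both sides of `B`, leaving a norm square. -/
theorem inner_lorentz_self (hd : discreteSpectrum A = {E})
    (h1 : Module.finrank ℂ (eigenspace A E) = 1) {e ε : ℝ} (hε : 0 < ε) {S : BddOp}
    (hS : IsInverseSqAdd A e ε (star S * S)) (v : Hil) :
    ⟪v, lorentz A e ε v⟫_ℂ = ((ε * ‖S (essProj A v)‖ ^ 2 : ℝ) : ℂ) := by
  obtain ⟨φ, hφ, hn⟩ := exists_unit_eigenvector h1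
  have hQ := essProj_apply hd h1 hφ hn
  have hBφ := hS.apply_eigenvector hε hφ
  set B := star S * S with hBdef
  set d : ℝ := ((E - e) ^ 2 + ε ^ 2)⁻¹
  have hBs : ∀ x y : Hil, ⟪B x, y⟫_ℂ = ⟪x, B y⟫_ℂ :=
    ContinuousLinearMap.isSelfAdjoint_iff_isSymmetric.mp (IsSelfAdjoint.star_mul_self S)
  have hφB : ∀ y : Hil, ⟪φ, B y⟫_ℂ = (d : ℂ) * ⟪φ, y⟫_ℂ := by
    intro y
    rw [← hBs, hBφ, inner_smul_left, Complex.conj_ofReal]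
  have hφQ : ⟪φ, essProj A v⟫_ℂ = 0 := by
    rw [hQ, inner_sub_right, inner_smul_right, inner_self_eq_norm_sq_to_K, hn]
    simp
  have hcomm : essProj A (B v) = B (essProj A v) := by
    rw [hQ, hQ, map_sub, map_smul, hφB, hBφ, smul_smul, mul_comm]
  have h2 : ⟪v, B (essProj A v)⟫_ℂ = ⟪essProj A v, B (essProj A v)⟫_ℂ := by
    conv_rhs => rw [hQ v, inner_sub_left, inner_smul_left, ← hQ v, hφB, hφQ, mul_zero, mul_zero,
      sub_zero]
  have h3 : ⟪essProj A v, B (essProj A v)⟫_ℂ = ((‖S (essProj A v)‖ ^ 2 : ℝ) : ℂ) := by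
    rw [hBdef]
    change ⟪essProj A v, S.adjoint (S (essProj A v))⟫_ℂ = _
    rw [ContinuousLinearMap.adjoint_inner_right, inner_self_eq_norm_sq_to_K]
    push_cast; rfl
  rw [lorentz, inverseSqAdd_eq hS]
  change ⟪v, (ε : ℂ) • essProj A (B v)⟫_ℂ = _
  rw [inner_smul_right, hcomm, h2, h3]
  push_cast; rfl

end Projection

/-! ### The coupling operators -/

section Coupling

theorem mulOp_const_mul {m : Space → ℂ} (hm : MemLp m ∞ volume) (c : ℂ) :
    mulOp (fun x => c * m x) = c • mulOp m := by
  refine ContinuousLinearMap.ext fun f => Lp.ext ?_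
  rw [smul_apply]
  filter_upwards [mulOp_coeFn hm f, mulOp_coeFn (hm.const_mul c) f,
    Lp.coeFn_smul c (mulOp m f)] with x h1 h2 h3
  rw [h3, h2, Pi.smul_apply, h1, smul_eq_mul, mul_assoc]

/-- The localized plane wave `x ↦ e^{i q·x} χ(α x)`. -/
def planeWave (χ : 𝓢(Space, ℂ)) (α : ℝ) (q x : Space) : ℂ :=
  Complex.exp (Complex.I * ((⟪q, x⟫_ℝ : ℝ) : ℂ)) * χ (α • x)

variable (χ : 𝓢(Space, ℂ)) (α : ℝ)

theorem norm_exp_I_mul_ofReal_eq_one (t : ℝ) : ‖Complex.exp (Complex.I * (t : ℂ))‖ = 1 := by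
  rw [mul_comm, Complex.norm_exp_ofReal_mul_I]

theorem continuous_planeWave (q : Space) : Continuous (planeWave χ α q) := by
  have := χ.continuous
  unfold planeWave
  fun_prop

theorem exists_norm_schwartz_le : ∃ C, 0 < C ∧ ∀ x, ‖χ x‖ ≤ C := by
  obtain ⟨C, hC, h⟩ := χ.decay 0 0
  exact ⟨C, hC, fun x => by simpa using h x⟩

theorem memLp_planeWave (q : Space) : MemLp (planeWave χ α q) ∞ volume := by
  obtain ⟨C, -, h⟩ := exists_norm_schwartz_le χ
  refine memLp_top_of_norm_le (continuous_planeWave χ α q).aestronglyMeasurable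
    (C := C) fun x => ?_
  rw [planeWave, norm_mul, norm_exp_I_mul_ofReal_eq_one, one_mul]
  exact h _

/-- Plane waves alone are not norm continuous in `q`. The cutoff repairs this: `|e^{i(q-q')·x} - 1|
≤ ‖q - q'‖ ‖x‖`, and Schwartz decay gives `‖x‖ |χ(α x)| ≤ C / α`. -/
theorem continuous_mulOp_planeWave (hα : 0 < α) : Continuous fun q => mulOp (planeWave χ α q) := by
  obtain ⟨C, hC, h⟩ := χ.decay 1 0
  refine (LipschitzWith.of_dist_le_mul (K := ⟨C / α, by positivity⟩) fun q q' => ?_).continuous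
  rw [dist_eq_norm, dist_eq_norm, mulOp_sub (memLp_planeWave χ α q) (memLp_planeWave χ α q')]
  refine norm_mulOp_le fun x => ?_
  have h1 : ‖x‖ * ‖χ (α • x)‖ ≤ C / α := by
    have := h (α • x)
    rw [pow_one, norm_iteratedFDeriv_zero, norm_smul, Real.norm_eq_abs, abs_of_pos hα] at this
    rw [le_div_iff₀ hα]
    linarith
  have h2 : planeWave χ α q x - planeWave χ α q' x =
      Complex.exp (Complex.I * ((⟪q', x⟫_ℝ : ℝ) : ℂ)) *
        ((Complex.exp (Complex.I * ((⟪q - q', x⟫_ℝ : ℝ) : ℂ)) - 1) * χ (α • x)) := by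
    have : Complex.exp (Complex.I * ((⟪q, x⟫_ℝ : ℝ) : ℂ)) =
        Complex.exp (Complex.I * ((⟪q', x⟫_ℝ : ℝ) : ℂ)) *
          Complex.exp (Complex.I * ((⟪q - q', x⟫_ℝ : ℝ) : ℂ)) := by
      rw [← Complex.exp_add, inner_sub_left]
      congr 1
      push_cast
      ring
    rw [planeWave, planeWave, this]
    ring
  rw [Pi.sub_apply, h2, norm_mul, norm_exp_I_mul_ofReal_eq_one, one_mul, norm_mul]
  change _ ≤ C / α * _
  calc _ ≤ ‖q - q'‖ * ‖x‖ * ‖χ (α • x)‖ := by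
        gcongr
        exact Real.norm_exp_I_mul_ofReal_sub_one_le.trans (norm_inner_le_norm _ _)
    _ = ‖q - q'‖ * (‖x‖ * ‖χ (α • x)‖) := by ring
    _ ≤ ‖q - q'‖ * (C / α) := by gcongr
    _ = _ := mul_comm _ _

theorem couplingFun_eq (κ : ℝ → ℂ) (k : ℝ × Dir) (x : Space) :
    couplingFun κ χ α k x = κ k.1 * planeWave χ α (k.1 • (k.2 : Space)) x := by
  rw [couplingFun, planeWave, mul_assoc, real_inner_smul_left]

theorem memLp_couplingFun (κ : ℝ → ℂ) (k : ℝ × Dir) : MemLp (couplingFun κ χ α k) ∞ volume := by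
  rw [funext (couplingFun_eq χ α κ k)]
  exact (memLp_planeWave χ α _).const_mul _

theorem coupling_eq (κ : ℝ → ℂ) (k : ℝ × Dir) :
    coupling κ χ α k = κ k.1 • mulOp (planeWave χ α (k.1 • (k.2 : Space))) := by
  rw [coupling, funext (couplingFun_eq χ α κ k), mulOp_const_mul (memLp_planeWave χ α _)]

theorem continuousOn_coupling {κ : ℝ → ℂ} (hκ : ContinuousOn κ (Ioi 0)) (hα : 0 < α) :
    ContinuousOn (coupling κ χ α) (Ioi 0 ×ˢ univ) := by
  rw [funext (coupling_eq χ α κ)]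
  refine ContinuousOn.smul (hκ.comp continuousOn_fst fun k hk => hk.1) ?_
  exact ((continuous_mulOp_planeWave χ α hα).comp (by fun_prop)).continuousOn

theorem exists_norm_coupling_le : ∃ M, 0 < M ∧ ∀ (κ : ℝ → ℂ) (k : ℝ × Dir),
    ‖coupling κ χ α k‖ ≤ M * ‖κ k.1‖ := by
  obtain ⟨C, hC, h⟩ := exists_norm_schwartz_le χ
  refine ⟨C, hC, fun κ k => norm_mulOp_le fun x => ?_⟩
  rw [couplingFun_eq, norm_mul, mul_comm]
  gcongr
  rw [planeWave, norm_mul, norm_exp_I_mul_ofReal_eq_one, one_mul]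
  exact h _

end Coupling

/-! ### Integrability in the modes -/

section Weights

/-- Both thermal weights are at most a multiple of `ω² + ω`. Near zero `ω |κ|²` stays bounded, even
for the critical singularity `ω^{-1/2}`. -/
theorem exists_form_factor_bound {κ : ℝ → ℂ} (hUV : UVCutoff κ) (hIR : InfraredBehavior κ) :
    ∃ C, 0 < C ∧ ∀ ω : ℝ, 0 < ω → (ω ^ 2 + ω) * ‖κ ω‖ ^ 2 ≤ C * (1 + ω ^ 2)⁻¹ := by
  obtain ⟨C₁, h₁⟩ : ∃ C, ∀ ω : ℝ, 0 < ω → ω ≤ 1 → ω * ‖κ ω‖ ^ 2 ≤ C := by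
    obtain ⟨hcont, ⟨k₁, k₂, p, hk₁, hk₂, hp, h⟩ | ⟨s, κ', hs, -, hb, h⟩⟩ := hIR
    · have hc : ContinuousOn κ (Icc k₁ 1) :=
        hcont.continuousOn.mono fun x hx => hk₁.trans_le hx.1
      obtain ⟨D, hD⟩ := isCompact_Icc.exists_bound_of_continuousOn hc
      refine ⟨max k₂ D ^ 2, fun ω h0 h1 => ?_⟩
      have hb : ‖κ ω‖ ≤ max k₂ D := by
        rcases lt_or_ge ω k₁ with hω | hω
        · have := h 0 (by norm_num) ω h0 hω
          rw [iteratedDerivWithin_zero, Nat.cast_zero, sub_zero] at this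
          refine (this.trans ?_).trans (le_max_left _ _)
          exact mul_le_of_le_one_right hk₂.le (Real.rpow_le_one h0.le h1 (by linarith))
        · exact (hD ω ⟨hω, h1⟩).trans (le_max_right _ _)
      calc ω * ‖κ ω‖ ^ 2 ≤ 1 * max k₂ D ^ 2 := by gcongr
        _ = _ := one_mul _
    · obtain ⟨C, hC⟩ := hb 0 (by norm_num)
      refine ⟨C ^ 2, fun ω h0 h1 => ?_⟩
      have h2 : ‖κ' ω‖ ≤ C := by simpa using hC ω h0.le
      have h3 : ω * (ω ^ s) ^ 2 ≤ 1 := by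
        rw [← Real.rpow_natCast, ← Real.rpow_mul h0.le]
        nth_rewrite 1 [← Real.rpow_one ω]
        rw [← Real.rpow_add h0]
        refine Real.rpow_le_one h0.le h1 ?_
        rcases hs with rfl | rfl <;> norm_num
      rw [h ω h0, norm_mul, Complex.norm_real, mul_pow, Real.norm_eq_abs, sq_abs, ← mul_assoc]
      calc ω * (ω ^ s) ^ 2 * ‖κ' ω‖ ^ 2 ≤ 1 * C ^ 2 := by gcongr
        _ = _ := one_mul _
  -- Order 2 suffices, because `(ω² + ω)(1 + ω²) ≤ 4 ω⁴` for `ω ≥ 1`.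
  obtain ⟨C₂, h₂⟩ := hUV 2
  refine ⟨4 * (|C₁| + C₂ ^ 2) + 1, by positivity, fun ω h0 => ?_⟩
  rw [← div_eq_mul_inv, le_div_iff₀ (by positivity)]
  rcases le_total ω 1 with hω | hω
  · have h3 : ω * ‖κ ω‖ ^ 2 ≤ |C₁| := (h₁ ω h0 hω).trans (le_abs_self _)
    have h4 : (1 + ω) * (1 + ω ^ 2) ≤ 4 := by nlinarith [sq_nonneg ω]
    calc (ω ^ 2 + ω) * ‖κ ω‖ ^ 2 * (1 + ω ^ 2) =
        ((1 + ω) * (1 + ω ^ 2)) * (ω * ‖κ ω‖ ^ 2) := by ring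
      _ ≤ 4 * |C₁| := by gcongr
      _ ≤ _ := by nlinarith [sq_nonneg C₂]
  · have h3 := h₂ ω hω
    have h4 : (1 + 1 / ω) * (1 + 1 / ω ^ 2) ≤ 4 := by
      have e1 : 1 / ω ≤ 1 := by rw [div_le_one h0]; exact hω
      have e2 : 1 / ω ^ 2 ≤ 1 := by
        rw [div_le_one (by positivity)]; exact one_le_pow₀ hω
      have e3 : 0 ≤ 1 / ω := by positivity
      have e4 : 0 ≤ 1 / ω ^ 2 := by positivity
      nlinarith
    calc (ω ^ 2 + ω) * ‖κ ω‖ ^ 2 * (1 + ω ^ 2) =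
        ((1 + 1 / ω) * (1 + 1 / ω ^ 2)) * (ω ^ 2 * ‖κ ω‖) ^ 2 := by field_simp; ring
      _ ≤ 4 * C₂ ^ 2 := by gcongr
      _ ≤ _ := by nlinarith [abs_nonneg C₁]

theorem modeMeasure_eq : modeMeasure =
    ((volume : Measure ℝ).prod (volume : Measure Space).toSphere).restrict (Ioi 0 ×ˢ univ) := by
  rw [modeMeasure, ← Measure.prod_restrict, Measure.restrict_univ]

theorem ae_modeMeasure_pos : ∀ᵐ k ∂modeMeasure, 0 < k.1 := by
  rw [modeMeasure_eq]
  filter_upwards [ae_restrict_mem (measurableSet_Ioi.prod MeasurableSet.univ)] with k hk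
  exact hk.1

theorem modeMeasure_prod_pos {U : Set ℝ} (hU : IsOpen U) {ω : ℝ} (hω : ω ∈ U) (h0 : 0 < ω) :
    0 < modeMeasure (U ×ˢ univ) := by
  rw [modeMeasure, Measure.prod_prod, Measure.restrict_apply hU.measurableSet]
  refine ENNReal.mul_pos ?_ ?_
  · exact ((hU.inter isOpen_Ioi).measure_pos volume ⟨ω, hω, h0⟩).ne'
  · rw [Measure.measure_univ_ne_zero]
    exact Measure.toSphere_ne_zero _

/-- `BddOp` is not separable, so strong measurability is obtained from norm continuity on the second
countable space of modes. -/
theorem integrable_modeMeasure {f : ℝ × Dir → BddOp} (hf : ContinuousOn f (Ioi 0 ×ˢ univ)) {C : ℝ}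
    (hC : ∀ k, 0 < k.1 → ‖f k‖ ≤ C * (1 + k.1 ^ 2)⁻¹) : Integrable f modeMeasure := by
  have h1 : Integrable (fun k : ℝ × Dir => C * (1 + k.1 ^ 2)⁻¹) modeMeasure :=
    ((integrable_inv_one_add_sq.integrableOn (s := Ioi 0)).comp_fst _).const_mul C
  refine h1.mono' ?_ (ae_modeMeasure_pos.mono hC)
  rw [modeMeasure_eq]
  exact hf.aestronglyMeasurable (measurableSet_Ioi.prod MeasurableSet.univ)

theorem integrable_weighted {κ : ℝ → ℂ} (hUV : UVCutoff κ) (hIR : InfraredBehavior κ)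
    {X Y : ℝ × Dir → BddOp} {L : ℝ → BddOp} {w : ℝ → ℝ} {M K c : ℝ}
    (hX : ContinuousOn X (Ioi 0 ×ˢ univ)) (hXM : ∀ k, ‖X k‖ ≤ M * ‖κ k.1‖)
    (hY : ContinuousOn Y (Ioi 0 ×ˢ univ)) (hYM : ∀ k, ‖Y k‖ ≤ M * ‖κ k.1‖)
    (hL : Continuous L) (hLK : ∀ ω, ‖L ω‖ ≤ K)
    (hw : ContinuousOn w (Ioi 0)) (hwc : ∀ ω, 0 < ω → |w ω| ≤ c * (ω ^ 2 + ω)) :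
    Integrable (fun k => ((w k.1 : ℝ) : ℂ) • (X k ∘L L k.1 ∘L Y k)) modeMeasure := by
  obtain ⟨C, hC, hb⟩ := exists_form_factor_bound hUV hIR
  have hK : 0 ≤ K := (norm_nonneg _).trans (hLK 0)
  refine integrable_modeMeasure (C := c * (M ^ 2 * K * C)) ?_ fun k hk => ?_
  · have hw' : ContinuousOn (fun k : ℝ × Dir => w k.1) (Ioi 0 ×ˢ univ) :=
      hw.comp continuousOn_fst fun k hk => hk.1
    have hL' : ContinuousOn (fun k : ℝ × Dir => L k.1) (Ioi 0 ×ˢ univ) :=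
      (hL.comp continuous_fst).continuousOn
    exact (Complex.continuous_ofReal.comp_continuousOn hw').smul (hX.clm_comp (hL'.clm_comp hY))
  · have hc : 0 ≤ c := by
      have := (abs_nonneg _).trans (hwc k.1 hk)
      exact nonneg_of_mul_nonneg_left this (by positivity)
    have hM : 0 ≤ M * ‖κ k.1‖ := (norm_nonneg _).trans (hXM k)
    have h1 : ‖X k ∘L L k.1 ∘L Y k‖ ≤ (M * ‖κ k.1‖) * (K * (M * ‖κ k.1‖)) := by
      refine (ContinuousLinearMap.opNorm_comp_le _ _).trans ?_
      refine mul_le_mul (hXM k) ?_ (norm_nonneg _) hM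
      refine (ContinuousLinearMap.opNorm_comp_le _ _).trans ?_
      exact mul_le_mul (hLK _) (hYM k) (norm_nonneg _) hK
    rw [norm_smul, Complex.norm_real, Real.norm_eq_abs]
    calc |w k.1| * ‖X k ∘L L k.1 ∘L Y k‖
        ≤ (c * (k.1 ^ 2 + k.1)) * ((M * ‖κ k.1‖) * (K * (M * ‖κ k.1‖))) :=
          mul_le_mul (hwc _ hk) h1 (norm_nonneg _) (by positivity)
      _ = c * (M ^ 2 * K) * ((k.1 ^ 2 + k.1) * ‖κ k.1‖ ^ 2) := by ring
      _ ≤ c * (M ^ 2 * K) * (C * (1 + k.1 ^ 2)⁻¹) :=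
          mul_le_mul_of_nonneg_left (hb _ hk) (by positivity)
      _ = _ := by ring

theorem bose_weight_nonneg {β ω : ℝ} (hβ : 0 < β) (hω : 0 < ω) :
    0 ≤ ω ^ 2 / (Real.exp (β * ω) - 1) := by
  have := Real.add_one_le_exp (β * ω)
  have : 0 < β * ω := by positivity
  exact div_nonneg (sq_nonneg _) (by linarith)

theorem bose_weight_le {β ω : ℝ} (hβ : 0 < β) (hω : 0 < ω) :
    ω ^ 2 / (Real.exp (β * ω) - 1) ≤ ω / β := by
  have h1 := Real.add_one_le_exp (β * ω)
  have h2 : 0 < β * ω := by positivity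
  calc ω ^ 2 / (Real.exp (β * ω) - 1) ≤ ω ^ 2 / (β * ω) := by gcongr; linarith
    _ = _ := by field_simp

/-- Spontaneous plus stimulated emission: the first term is free of `β`, the second nonnegative.
This makes `γ` uniform in the temperature. -/
theorem emission_weight_eq {β ω : ℝ} (hβ : 0 < β) (hω : 0 < ω) :
    ω ^ 2 / (1 - Real.exp (-(β * ω))) = ω ^ 2 + ω ^ 2 / (Real.exp (β * ω) - 1) := by
  have h1 := Real.add_one_le_exp (β * ω)
  have h2 : 0 < β * ω := by positivity
  have h3 : Real.exp (β * ω) - 1 ≠ 0 := by linarith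
  have h4 : (1 : ℝ) - (Real.exp (β * ω))⁻¹ = (Real.exp (β * ω) - 1) / Real.exp (β * ω) := by
    field_simp
  rw [Real.exp_neg, h4]
  have h5 := (Real.exp_pos (β * ω)).ne'
  generalize Real.exp (β * ω) = y at h3 h5 ⊢
  field_simp
  ring

end Weights

/-! ### Level sets of plane waves -/

theorem volume_inner_eq {q : Space} (hq : q ≠ 0) (t : ℝ) :
    volume {x : Space | ⟪q, x⟫_ℝ = t} = 0 := by
  rcases eq_empty_or_nonempty {x : Space | ⟪q, x⟫_ℝ = t} with h | ⟨x₀, hx₀⟩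
  · rw [h, measure_empty]
  · let s := AffineSubspace.mk' x₀ (ℝ ∙ q)ᗮ
    have hs : s ≠ ⊤ := by
      intro h
      have h1 : x₀ + q ∈ s := h ▸ AffineSubspace.mem_top _ _ _
      rw [AffineSubspace.mem_mk', vsub_eq_sub, add_sub_cancel_left,
        Submodule.mem_orthogonal_singleton_iff_inner_right, inner_self_eq_zero] at h1
      exact hq h1
    refine measure_mono_null (fun x hx => ?_) (Measure.addHaar_affineSubspace volume s hs)
    change x ∈ s
    rw [AffineSubspace.mem_mk', vsub_eq_sub, Submodule.mem_orthogonal_singleton_iff_inner_right,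
      inner_sub_right, sub_eq_zero]
    exact Eq.trans hx hx₀.symm

/-- By `2πi`-periodicity of the exponential, a level set is covered by countably many parallel
hyperplanes. -/
theorem volume_exp_inner_eq {q : Space} (hq : q ≠ 0) (a : ℂ) :
    volume {x : Space | Complex.exp (Complex.I * ((⟪q, x⟫_ℝ : ℝ) : ℂ)) = a} = 0 := by
  rcases eq_empty_or_nonempty {x : Space | Complex.exp (Complex.I * ((⟪q, x⟫_ℝ : ℝ) : ℂ)) = a}
    with h | ⟨x₀, rfl⟩
  · rw [h, measure_empty]
  · refine measure_mono_null (t := ⋃ n : ℤ, {x : Space | ⟪q, x⟫_ℝ = ⟪q, x₀⟫_ℝ + n * (2 * Real.pi)})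
      (fun x hx => ?_) (measure_iUnion_null fun n => volume_inner_eq hq _)
    obtain ⟨n, hn⟩ := Complex.exp_eq_exp_iff_exists_int.1 hx
    refine mem_iUnion.2 ⟨n, ?_⟩
    have := congrArg Complex.im hn
    simpa using this

/-- Where `χ(α x) = c` and `φ x ≠ 0`, equality would allow cancelling `φ x` and force the plane wave
to be the constant `a / (κ c)`, which happens only on a null set. -/
theorem coupling_apply_ne_smul {χ : 𝓢(Space, ℂ)} {c : ℂ} (hc : c ≠ 0) {α : ℝ} {φ : Hil}
    (hS : volume {x | χ (α • x) = c ∧ φ x ≠ 0} ≠ 0) {κ : ℝ → ℂ} {k : ℝ × Dir} (hk : 0 < k.1)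
    (hκ : κ k.1 ≠ 0) (a : ℂ) : coupling κ χ α k φ ≠ a • φ := by
  intro h
  apply hS
  have hq : k.1 • (k.2 : Space) ≠ 0 :=
    smul_ne_zero hk.ne' (norm_ne_zero_iff.1 (by rw [norm_eq_of_mem_sphere k.2]; exact one_ne_zero))
  have h1 : ∀ᵐ x, couplingFun κ χ α k x * φ x = a * φ x := by
    filter_upwards [mulOp_coeFn (memLp_couplingFun χ α κ k) φ, Lp.coeFn_smul a φ] with x e1 e2
    rw [← e1]
    change (coupling κ χ α k φ : Hil) x = _
    rw [h, e2]; rfl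
  refine measure_mono_null (t := {x | ¬ couplingFun κ χ α k x * φ x = a * φ x} ∪
    {x | Complex.exp (Complex.I * ((⟪k.1 • (k.2 : Space), x⟫_ℝ : ℝ) : ℂ)) = a / (κ k.1 * c)})
    (fun x hx => ?_) (measure_union_null h1 (volume_exp_inner_eq hq _))
  by_cases hx1 : couplingFun κ χ α k x * φ x = a * φ x
  · right
    have h2 := mul_right_cancel₀ hx.2 hx1
    rw [couplingFun_eq, planeWave, hx.1] at h2
    change _ = _
    rw [← h2]
    field_simp
  · exact Or.inl hx1

theorem exists_scale {χ : 𝓢(Space, ℂ)} {c : ℂ} (hχ : ∀ᶠ x in 𝓝 (0 : Space), χ x = c)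
    {φ : Hil} (hφ : φ ≠ 0) : ∃ α : ℝ, 0 < α ∧ volume {x | χ (α • x) = c ∧ φ x ≠ 0} ≠ 0 := by
  obtain ⟨r, hr, hball⟩ := Metric.eventually_nhds_iff.1 hχ
  by_contra! hcon
  apply hφ
  rw [Lp.eq_zero_iff_ae_eq_zero]
  -- Along the scales `r / (n + 1)` the regions where `χ(α x) = c` exhaust space; were all the
  -- intersections null, `φ` would vanish almost everywhere.
  refine measure_mono_null (t := ⋃ n : ℕ, {x | χ ((r / (n + 1)) • x) = c ∧ φ x ≠ 0})
    (fun x hx => ?_) (measure_iUnion_null fun n => hcon _ (by positivity))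
  obtain ⟨n, hn⟩ := exists_nat_gt ‖x‖
  refine mem_iUnion.2 ⟨n, hball ?_, hx⟩
  rw [dist_zero_right, norm_smul, Real.norm_eq_abs, abs_of_pos (by positivity), div_mul_eq_mul_div,
    div_lt_iff₀ (by positivity)]
  gcongr
  linarith

/-! ### Compressions to a simple eigenvalue -/

section Compression

variable {A : Hil →ₗ.[ℂ] Hil} {E : ℝ}

theorem eigenProj_comp_comp (h1 : Module.finrank ℂ (eigenspace A E) = 1) {φ : Hil}
    (hφ : φ ∈ eigenspace A E) (hn : ‖φ‖ = 1) (T : BddOp) :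
    eigenProj A E ∘L T ∘L eigenProj A E = ⟪φ, T φ⟫_ℂ • eigenProj A E := by
  refine ContinuousLinearMap.ext fun w => ?_
  change eigenProj A E (T (eigenProj A E w)) = ⟪φ, T φ⟫_ℂ • eigenProj A E w
  rw [eigenProj_apply h1 hφ hn, eigenProj_apply h1 hφ hn w, map_smul, inner_smul_right, smul_smul,
    mul_comm]

theorem smul_eigenProj_le (h1 : Module.finrank ℂ (eigenspace A E) = 1) {φ : Hil}
    (hφ : φ ∈ eigenspace A E) (hn : ‖φ‖ = 1) {T : BddOp} {γ t : ℝ} (ht : ⟪φ, T φ⟫_ℂ = (t : ℂ))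
    (hγ : γ ≤ t) : (γ : ℂ) • eigenProj A E ≤ eigenProj A E ∘L T ∘L eigenProj A E := by
  rw [eigenProj_comp_comp h1 hφ hn, ht, ContinuousLinearMap.le_def, ← sub_smul,
    ← Complex.ofReal_sub]
  refine ContinuousLinearMap.IsPositive.smul_of_nonneg
    (.of_isStarProjection isStarProjection_starProjection) ?_
  exact_mod_cast sub_nonneg.2 hγ

theorem inner_smul_adjoint_comp (w : ℂ) (X L : BddOp) (φ : Hil) :
    ⟪φ, (w • (X.adjoint ∘L L ∘L X)) φ⟫_ℂ = w * ⟪X φ, L (X φ)⟫_ℂ := by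
  change ⟪φ, w • X.adjoint (L (X φ))⟫_ℂ = _
  rw [inner_smul_right, ContinuousLinearMap.adjoint_inner_right]

theorem inner_integral_apply {X : Type*} [MeasurableSpace X] {ν : Measure X} {f : X → BddOp}
    (hf : Integrable f ν) {φ : Hil} {g : X → ℝ} (hg : ∀ k, ⟪φ, f k φ⟫_ℂ = (g k : ℂ)) :
    Integrable g ν ∧ ⟪φ, (∫ k, f k ∂ν) φ⟫_ℂ = ((∫ k, g k ∂ν : ℝ) : ℂ) := by
  let Λ : BddOp →L[ℂ] ℂ := innerSL ℂ φ ∘L ContinuousLinearMap.apply ℂ Hil φ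
  have h1 : ∀ k, Λ (f k) = (g k : ℂ) := hg
  constructor
  · have := (Λ.integrable_comp hf).re
    simp only [h1] at this
    exact this
  · have := Λ.integral_comp_comm hf
    simp only [h1] at this
    rw [← integral_complex_ofReal, this]
    rfl

end Compression

/-! ### The Fermi Golden Rule at a simple eigenvalue -/

theorem exists_fermiGoldenRule {A : Hil →ₗ.[ℂ] Hil} {μ : ℝ} {R : BddOp} (hR : IsSelfAdjoint R)
    (hA : IsShiftInverse A μ R) {E : ℝ} (hdisc : discreteSpectrum A = {E})
    (hsimple : Module.finrank ℂ (eigenspace A E) = 1) {χ : 𝓢(Space, ℂ)} {c : ℂ} (hc : c ≠ 0)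
    (hχ : ∀ᶠ x in 𝓝 (0 : Space), χ x = c) {κ : ℝ → ℂ} (hUV : UVCutoff κ)
    (hIR : InfraredBehavior κ) (hκ : ∃ ω : ℝ, 0 < ω ∧ κ ω ≠ 0) {ε : ℝ} (hε : 0 < ε) :
    ∃ α : ℝ, 0 < α ∧ ∃ γ : ℝ, 0 < γ ∧ ∀ β : ℝ, 0 < β →
      Integrable (integrandTwo A (coupling κ χ α) β ε E) modeMeasure ∧
      (γ : ℂ) • eigenProj A E ≤
        eigenProj A E ∘L levelShiftTwo A (coupling κ χ α) β ε E ∘L eigenProj A E ∧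
      FermiGoldenRule A (coupling κ χ α) β ε γ := by
  obtain ⟨S, hSc, hSn, hS⟩ := hA.exists_factor hR hε
  obtain ⟨φ, hφ, hn⟩ := exists_unit_eigenvector hsimple
  have hφ0 : φ ≠ 0 := norm_ne_zero_iff.1 (by rw [hn]; exact one_ne_zero)
  obtain ⟨α, hα, hpos⟩ := exists_scale hχ hφ0
  obtain ⟨M, -, hM⟩ := exists_norm_coupling_le χ α
  have hκc : ContinuousOn κ (Ioi 0) := hIR.1.continuousOn
  set G := coupling κ χ α
  have hGc : ContinuousOn G (Ioi 0 ×ˢ univ) := continuousOn_coupling χ α hκc hα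
  have hGn : ∀ k, ‖G k‖ ≤ M * ‖κ k.1‖ := hM κ
  have hGc' : ContinuousOn (fun k => (G k).adjoint) (Ioi 0 ×ˢ univ) :=
    ContinuousLinearMap.adjoint.continuous.comp_continuousOn hGc
  have hGn' : ∀ k, ‖(G k).adjoint‖ ≤ M * ‖κ k.1‖ := fun k => by
    rw [LinearIsometryEquiv.norm_map]; exact hGn k
  have hlor : ∀ e, lorentz A e ε = (ε : ℂ) • (essProj A ∘L (star (S e) * S e)) := fun e => by
    rw [lorentz, inverseSqAdd_eq (hS e)]
  have hLc : Continuous fun e => lorentz A e ε := by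
    simp only [hlor]
    have hc' : Continuous fun e => essProj A * (star (S e) * S e) :=
      continuous_const.mul (hSc.star.mul hSc)
    exact hc'.const_smul (ε : ℂ)
  have hLn : ∀ e, ‖lorentz A e ε‖ ≤ ε * (‖essProj A‖ * (ε⁻¹ * ε⁻¹)) := fun e => by
    rw [hlor, norm_smul, Complex.norm_real, Real.norm_eq_abs, abs_of_pos hε]
    gcongr
    refine (ContinuousLinearMap.opNorm_comp_le _ _).trans ?_
    gcongr
    have hs : ‖star (S e)‖ ≤ ε⁻¹ := (LinearIsometryEquiv.norm_map _ _).le.trans (hSn e)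
    exact (norm_mul_le _ _).trans (mul_le_mul hs (hSn e) (norm_nonneg _) (inv_pos.2 hε).le)
  have hquad := fun e v => inner_lorentz_self hdisc hsimple hε (hS e) v
  -- The zero temperature integrand, with weight `ω²`; its expectation in `φ` will be `γ`.
  have hint0 : Integrable (fun k => ((k.1 ^ 2 : ℝ) : ℂ) •
      ((G k).adjoint ∘L lorentz A (E - k.1) ε ∘L G k)) modeMeasure :=
    integrable_weighted hUV hIR (L := fun ω => lorentz A (E - ω) ε) (w := fun ω => ω ^ 2) (c := 1)
      hGc' hGn' hGc hGn (hLc.comp (by fun_prop)) (fun ω => hLn _) (by fun_prop)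
      fun ω hω => by rw [abs_of_nonneg (sq_nonneg ω)]; linarith
  have hint1 : ∀ β, 0 < β → Integrable (integrandOne A G β ε E) modeMeasure := fun β hβ =>
    integrable_weighted hUV hIR (L := fun ω => lorentz A (E + ω) ε)
      (w := fun ω => ω ^ 2 / (Real.exp (β * ω) - 1)) (c := 1 / β)
      hGc hGn hGc' hGn' (hLc.comp (by fun_prop)) (fun ω => hLn _)
      (by
        refine ContinuousOn.div (by fun_prop) (by fun_prop) fun ω hω => ?_
        have h1 := Real.add_one_le_exp (β * ω)
        have h2 : 0 < β * ω := mul_pos hβ hω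
        linarith)
      fun ω hω => by
        rw [abs_of_nonneg (bose_weight_nonneg hβ hω)]
        refine (bose_weight_le hβ hω).trans ?_
        rw [div_mul_eq_mul_div, one_mul]
        gcongr
        linarith [sq_nonneg ω]
  have hint2 : ∀ β, 0 < β → Integrable (integrandTwo A G β ε E) modeMeasure := fun β hβ =>
    integrable_weighted hUV hIR (L := fun ω => lorentz A (E - ω) ε)
      (w := fun ω => ω ^ 2 / (1 - Real.exp (-(β * ω)))) (c := 1 + 1 / β)
      hGc' hGn' hGc hGn (hLc.comp (by fun_prop)) (fun ω => hLn _)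
      (by
        refine ContinuousOn.div (by fun_prop) (by fun_prop) fun ω hω => ?_
        have h2 : 0 < β * ω := mul_pos hβ hω
        exact (sub_pos.2 (Real.exp_lt_one_iff.2 (neg_lt_zero.2 h2))).ne')
      fun ω hω => by
        have h1 := bose_weight_nonneg hβ hω
        rw [emission_weight_eq hβ hω, abs_of_nonneg (by positivity)]
        have h2 := bose_weight_le hβ hω
        have h3 : 0 ≤ 1 / β * ω ^ 2 := by positivity
        calc _ ≤ ω ^ 2 + ω / β := by linarith
          _ = ω ^ 2 + 1 / β * ω := by ring
          _ ≤ _ := by linarith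
  let N : ℝ × Dir → ℝ := fun k => ε * ‖S (E - k.1) (essProj A (G k φ))‖ ^ 2
  have hN0 : ∀ k, 0 ≤ N k := fun k => by positivity
  obtain ⟨hi0, -⟩ := inner_integral_apply hint0 (φ := φ) (g := fun k => k.1 ^ 2 * N k) fun k => by
    rw [inner_smul_adjoint_comp, hquad, ← Complex.ofReal_mul]
  have hγ : 0 < ∫ k, k.1 ^ 2 * N k ∂modeMeasure := by
    rw [integral_pos_iff_support_of_nonneg (fun k => mul_nonneg (sq_nonneg _) (hN0 k)) hi0]
    obtain ⟨ω, hω, hκω⟩ := hκ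
    -- Continuity of `κ` spreads a single nonzero value to an open set of frequencies, on which the
    -- integrand is shown to be nonzero.
    have hU : IsOpen (Ioi 0 ∩ κ ⁻¹' {0}ᶜ) :=
      hκc.isOpen_inter_preimage isOpen_Ioi isOpen_compl_singleton
    refine (modeMeasure_prod_pos hU ⟨hω, hκω⟩ hω).trans_le (measure_mono ?_)
    rintro k ⟨⟨hk, hκk⟩, -⟩
    refine mul_ne_zero (pow_ne_zero _ (ne_of_gt hk)) (mul_ne_zero hε.ne' (pow_ne_zero _ ?_))
    rw [norm_ne_zero_iff]
    intro h0
    have h1 : (star (S (E - k.1)) * S (E - k.1)) (essProj A (G k φ)) = 0 := by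
      change star (S (E - k.1)) (S (E - k.1) (essProj A (G k φ))) = 0
      rw [h0, map_zero]
    have h2 := (hS _).injective h1
    rw [essProj_apply hdisc hsimple hφ hn, sub_eq_zero] at h2
    exact coupling_apply_ne_smul hc hpos hk hκk _ h2
  refine ⟨α, hα, ∫ k, k.1 ^ 2 * N k ∂modeMeasure, hγ, fun β hβ => ?_⟩
  obtain ⟨hi2, he2⟩ := inner_integral_apply (hint2 β hβ) (φ := φ)
    (g := fun k => k.1 ^ 2 / (1 - Real.exp (-(β * k.1))) * N k) fun k => by
      rw [integrandTwo, inner_smul_adjoint_comp, hquad, ← Complex.ofReal_mul]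
  obtain ⟨-, he1⟩ := inner_integral_apply (hint1 β hβ) (φ := φ)
    (g := fun k => k.1 ^ 2 / (Real.exp (β * k.1) - 1) *
      (ε * ‖S (E + k.1) (essProj A ((G k).adjoint φ))‖ ^ 2)) fun k => by
      -- In `F⁽¹⁾` the roles of `G` and `G*` are exchanged, so the identity is applied to the
      -- adjoint.
      have := inner_smul_adjoint_comp ((k.1 ^ 2 / (Real.exp (β * k.1) - 1) : ℝ) : ℂ) (G k).adjoint
        (lorentz A (E + k.1) ε) φ
      rw [ContinuousLinearMap.adjoint_adjoint] at this
      rw [integrandOne, this, hquad, ← Complex.ofReal_mul]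
  have hge2 : ∫ k, k.1 ^ 2 * N k ∂modeMeasure ≤
      ∫ k, k.1 ^ 2 / (1 - Real.exp (-(β * k.1))) * N k ∂modeMeasure := by
    refine integral_mono_ae hi0 hi2 (ae_modeMeasure_pos.mono fun k hk => ?_)
    refine mul_le_mul_of_nonneg_right ?_ (hN0 k)
    rw [emission_weight_eq hβ hk]
    linarith [bose_weight_nonneg hβ hk]
  have hge1 : 0 ≤ ∫ k, k.1 ^ 2 / (Real.exp (β * k.1) - 1) *
      (ε * ‖S (E + k.1) (essProj A ((G k).adjoint φ))‖ ^ 2) ∂modeMeasure :=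
    integral_nonneg_of_ae (ae_modeMeasure_pos.mono fun k hk =>
      mul_nonneg (bose_weight_nonneg hβ hk) (by positivity))
  refine ⟨hint2 β hβ, smul_eigenProj_le hsimple hφ hn he2 hge2, hγ, fun E' hE' => ?_⟩
  rw [hdisc, mem_singleton_iff] at hE'
  subst hE'
  refine ⟨hint1 β hβ, hint2 β hβ, smul_eigenProj_le hsimple hφ hn
    (t := (∫ k, k.1 ^ 2 / (Real.exp (β * k.1) - 1) *
      (ε * ‖S (E' + k.1) (essProj A ((G k).adjoint φ))‖ ^ 2) ∂modeMeasure) +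
      ∫ k, k.1 ^ 2 / (1 - Real.exp (-(β * k.1))) * N k ∂modeMeasure) ?_ (by linarith)⟩
  rw [add_apply, inner_add_right, Complex.ofReal_add]
  exact congrArg₂ _ he1 he2

end ThermalIonization

end

/-! ### Application to the Schrödinger operator -/

theorem mainTheorem3
    -- the potential: smooth, compactly supported, nonpositive
    (V : ThermalIonization.Space → ℝ) (hV : ContDiff ℝ ((⊤ : ℕ∞) : WithTop ℕ∞) V) (hVc : HasCompactSupport V)
    (hV0 : ∀ x, V x ≤ 0)
    -- `-Δ + V` has exactly one discrete eigenvalue, which is negative and non-degenerate,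
    -- and zero is not an eigenvalue
    (E : ℝ) (hE : E < 0)
    (hdisc : ThermalIonization.discreteSpectrum (ThermalIonization.schrodinger V) = {E})
    (hsimple :
      Module.finrank ℂ (ThermalIonization.eigenspace (ThermalIonization.schrodinger V) E) = 1)
    (hzero : ThermalIonization.eigenspace (ThermalIonization.schrodinger V) 0 = ⊥)
    -- the spatial cutoff: Schwartz, constant and nonzero near the origin
    (χ : 𝓢(ThermalIonization.Space, ℂ)) (c : ℂ) (hc : c ≠ 0)
    (hχ : ∀ᶠ x in 𝓝 (0 : ThermalIonization.Space), χ x = c)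
    -- the form factor, not identically zero
    (κ : ℝ → ℂ) (hUV : ThermalIonization.UVCutoff κ)
    (hIR : ThermalIonization.InfraredBehavior κ) (hκ : ∃ ω : ℝ, 0 < ω ∧ κ ω ≠ 0)
    (ε : ℝ) (hε : 0 < ε) :
    ∃ α : ℝ, 0 < α ∧ ∃ γ : ℝ, 0 < γ ∧ ∀ β : ℝ, 0 < β →
      let H := ThermalIonization.schrodinger V
      let G := ThermalIonization.coupling κ χ α
      let p := ThermalIonization.eigenProj H E
      let F := ThermalIonization.levelShiftTwo H G β ε E
      Integrable (ThermalIonization.integrandTwo H G β ε E) ThermalIonization.modeMeasure ∧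
      (γ : ℂ) • p ≤ p ∘L F ∘L p ∧
      (∀ φ ∈ ThermalIonization.eigenspace H E, ‖φ‖ = 1 → p ∘L F ∘L p = ⟪φ, F φ⟫_ℂ • p) ∧
      ThermalIonization.FermiGoldenRule H G β ε γ := by
  have hVcont : Continuous fun x => (V x : ℂ) := Complex.continuous_ofReal.comp hV.continuous
  obtain ⟨v, hv⟩ := (hVc.comp_left (g := ((↑) : ℝ → ℂ)) Complex.ofReal_zero).exists_bound_of_continuous
    hVcont
  obtain ⟨μ, R, hR, hA⟩ := ThermalIonization.exists_isShiftInverse_schrodinger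
    (ThermalIonization.memLp_top_of_norm_le hVcont.aestronglyMeasurable hv) hv
  obtain ⟨α, hα, γ, hγ, h⟩ :=
    ThermalIonization.exists_fermiGoldenRule hR hA hdisc hsimple hc hχ hUV hIR hκ hε
  refine ⟨α, hα, γ, hγ, fun β hβ => ?_⟩
  obtain ⟨h1, h2, h3⟩ := h β hβ
  exact ⟨h1, h2, fun φ hφ hn => ThermalIonization.eigenProj_comp_comp hsimple hφ hn _, h3⟩
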